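/- Let $X\in\mathbb R^{m\times d}$ be a fixed matrix without zero columns, put $\mathbb X=X^\top X$, let $p\in(0,1)$, and let $\alpha>0$ satisfy $\alpha\|\mathbb X\|<2$, where $\|\cdot\|$ is the spectral norm. For $d\times d$ matrices $A$ let $\mathrm{Diag}(A)$ be the diagonal matrix with the diagonal of $A$, and $A_p=pA+(1-p)\mathrm{Diag}(A)$. Let $(D_k)_{k\in\mathbb Z}$ be i.i.d. $p$-dropout matrices, i.e. random diagonal matrices whose $d$ diagonal entries are i.i.d. Bernoulli($p$). For $y\in\mathbb R^m$ and a diagonal matrix $D$ put $f_D(b)=b+\alpha DX^\top(y-XDb)$, $b\in\mathbb R^d$, and, for a fixed initial vector $\tilde\beta_0\in\mathbb R^d$, $$\tilde\beta_k=f_{D_k}(\tilde\beta_{k-1})\ (k\ge 1),\qquad \bar\beta_n^{\mathrm{gd}}(\alpha)=\frac1n\sum_{k=1}^n\tilde\beta_k,\qquad \tilde\beta=\mathbb X_p^{-1}X^\top y .$$ (A) Conditionally on the data, i.e. for every fixed $y\in\mathbb R^m$: 1. $\tilde\beta$ is the unique minimizer of $b\mapsto \mathbb E_D\big[\tfrac12\|y-XDb\|_2^2\big]$,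 where $D$ is a $p$-dropout matrix. 2. For every $k\in\mathbb Z$, almost surely the limit $\tilde\beta_k^\circ(\alpha)=\lim_{j\to\infty}f_{D_k}\circ f_{D_{k-1}}\circ\cdots\circ f_{D_{k-j}}(b)$ exists for all $b\in\mathbb R^d$ and does not depend on $b$. Its law $\pi_\alpha$ does not depend on $k$ and is the unique stationary distribution of the recursion, i.e. the unique probability measure $\pi$ on $\mathbb R^d$ such that $b\sim\pi$ and an independent $p$-dropout matrix $D$ give $f_D(b)\sim\pi$. 3. Each $\tilde\beta_k^\circ(\alpha)$ is square integrable, the series $$\Sigma(\alpha)=\sum_{k=-\infty}^{\infty}\mathrm{Cov}\big(\tilde\beta_0^\circ(\alpha),\tilde\beta_k^\circ(\alpha)\big)$$ converges absolutely entrywise, and the long-run covariance matrix $\Sigma(\alpha)$ is symmetric positive semidefinite. 4. For every fixed initial vector $\tilde\beta_0\in\mathbb R^d$, as $n\to\infty$, $$\sqrt n\big(\bar\beta_n^{\mathrm{gd}}(\alpha)-\tilde\beta\big)\Rightarrow\mathcal N\big(0,\Sigma(\alpha)\big).$$ (B) If $y=X\beta^*+\varepsilon$ with $\beta^*\in\mathbb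 R^d$ and any random vector $\varepsilon$ independent of $(D_k)_{k\in\mathbb Z}$ (in particular one with mean $0$ and covariance $I_m$), then for every fixed $\tilde\beta_0\in\mathbb R^d$, almost surely, the regular conditional distribution of $\sqrt n(\bar\beta_n^{\mathrm{gd}}(\alpha)-\tilde\beta)$ given $y$ converges weakly to $\mathcal N(0,\Sigma(\alpha))$, where $\Sigma(\alpha)$ is the matrix from (A) for the observed value of $y$. -/

import Mathlib

open MeasureTheory ProbabilityTheory Filter Topology

namespace GDDropout

noncomputable section

variable {m d : ℕ}

/-- The law on `{0,1}^d ⊆ ℝ^d` of the diagonal of a `p`-dropout matrix: the `d` diagonal entries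
are i.i.d. Bernoulli(`p`), i.e. equal to `1` with probability `p` and to `0` with probability
`1 - p`. -/
def dropoutLaw (d : ℕ) (p : unitInterval) : Measure (Fin d → ℝ) :=
  Measure.pi fun _ => bernoulliMeasure (1 : ℝ) 0 p

/-- The Gram matrix `𝕏 = Xᵀ X`. -/
def gram (X : Matrix (Fin m) (Fin d) ℝ) : Matrix (Fin d) (Fin d) ℝ :=
  X.transpose * X

/-- `A_p = p A + (1 - p) Diag(A)`. -/
def rescaled (p : ℝ) (A : Matrix (Fin d) (Fin d) ℝ) : Matrix (Fin d) (Fin d) ℝ :=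
  p • A + (1 - p) • Matrix.diagonal A.diag

/-- The `ℓ²`-regularized least-squares estimator `𝕏_p⁻¹ Xᵀ y`. -/
def regEstimator (X : Matrix (Fin m) (Fin d) ℝ) (p : ℝ) (y : EuclideanSpace ℝ (Fin m)) :
    EuclideanSpace ℝ (Fin d) :=
  Matrix.toEuclideanLin ((rescaled p (gram X))⁻¹ * X.transpose) y

/-- The least-squares risk with dropout, `E_D [½ ‖y - X D b‖²]`, the expectation being over the
`p`-dropout matrix `D` only. -/
def dropoutRisk (X : Matrix (Fin m) (Fin d) ℝ) (p : unitInterval) (y : EuclideanSpace ℝ (Fin m))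
    (b : EuclideanSpace ℝ (Fin d)) : ℝ :=
  ∫ δ, (1 / 2 : ℝ) * ‖y - Matrix.toEuclideanLin (X * Matrix.diagonal δ) b‖ ^ 2 ∂(dropoutLaw d p)

/-- One gradient step with dropout matrix `D = diag(δ)`:
`f_D(b) = b + α D Xᵀ (y - X D b)`. -/
def gdStep (X : Matrix (Fin m) (Fin d) ℝ) (y : EuclideanSpace ℝ (Fin m)) (α : ℝ)
    (δ : Fin d → ℝ) (b : EuclideanSpace ℝ (Fin d)) : EuclideanSpace ℝ (Fin d) :=
  b + α • Matrix.toEuclideanLin (Matrix.diagonal δ * X.transpose)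
    (y - Matrix.toEuclideanLin (X * Matrix.diagonal δ) b)

/-- The dropout iterates `β_0 = b₀`, `β_k = f_{D_k}(β_{k-1})`, driven by `D_1, D_2, …`. -/
def gdIterate (X : Matrix (Fin m) (Fin d) ℝ) (y : EuclideanSpace ℝ (Fin m)) (α : ℝ)
    (δ : ℤ → Fin d → ℝ) (b₀ : EuclideanSpace ℝ (Fin d)) : ℕ → EuclideanSpace ℝ (Fin d)
  | 0 => b₀
  | k + 1 => gdStep X y α (δ ((k : ℤ) + 1)) (gdIterate X y α δ b₀ k)

/-- The averaged iterate `(1/n) ∑_{k=1}^n β_k`. -/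
def gdAverage (X : Matrix (Fin m) (Fin d) ℝ) (y : EuclideanSpace ℝ (Fin m)) (α : ℝ)
    (δ : ℤ → Fin d → ℝ) (b₀ : EuclideanSpace ℝ (Fin d)) (n : ℕ) : EuclideanSpace ℝ (Fin d) :=
  (1 / (n : ℝ)) • ∑ k ∈ Finset.Icc 1 n, gdIterate X y α δ b₀ k

/-- The normalized error `√n (β̄_n - β̃)`. -/
def gdError (X : Matrix (Fin m) (Fin d) ℝ) (p : unitInterval) (y : EuclideanSpace ℝ (Fin m))
    (α : ℝ) (δ : ℤ → Fin d → ℝ) (b₀ : EuclideanSpace ℝ (Fin d)) (n : ℕ) :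
    EuclideanSpace ℝ (Fin d) :=
  √(n : ℝ) • (gdAverage X y α δ b₀ n - regEstimator X p y)

/-- The backward composition `f_{D_k} ∘ f_{D_{k-1}} ∘ ⋯ ∘ f_{D_{k-j}} (b)`. -/
def gdBackward (X : Matrix (Fin m) (Fin d) ℝ) (y : EuclideanSpace ℝ (Fin m)) (α : ℝ)
    (δ : ℤ → Fin d → ℝ) (k : ℤ) : ℕ → EuclideanSpace ℝ (Fin d) → EuclideanSpace ℝ (Fin d)
  | 0, b => gdStep X y α (δ k) b
  | j + 1, b => gdBackward X y α δ k j (gdStep X y α (δ (k - ((j : ℤ) + 1))) b)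

/-- The stationary iterate `β°_k = lim_{j → ∞} f_{D_k} ∘ ⋯ ∘ f_{D_{k-j}} (0)`, for `k ∈ ℤ`. -/
def gdStationary (X : Matrix (Fin m) (Fin d) ℝ) (y : EuclideanSpace ℝ (Fin m)) (α : ℝ)
    (δ : ℤ → Fin d → ℝ) (k : ℤ) : EuclideanSpace ℝ (Fin d) :=
  limUnder atTop fun j : ℕ => gdBackward X y α δ k j 0

/-- `π` is a stationary distribution of the dropout recursion: if `b ∼ π` and the `p`-dropout
matrix `D` is independent of `b`, then `f_D(b) ∼ π`. -/
def IsStationaryLaw (X : Matrix (Fin m) (Fin d) ℝ) (p : unitInterval)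
    (y : EuclideanSpace ℝ (Fin m)) (α : ℝ) (π : Measure (EuclideanSpace ℝ (Fin d))) : Prop :=
  IsProbabilityMeasure π ∧
    (π.prod (dropoutLaw d p)).map (fun z => gdStep X y α z.2 z.1) = π

variable {Ω : Type*} [MeasurableSpace Ω]

/-- The entry `(i, j)` of the cross-covariance matrix `Cov(β°_0, β°_k)`, for fixed `y`. -/
def stationaryCov (X : Matrix (Fin m) (Fin d) ℝ) (y : EuclideanSpace ℝ (Fin m)) (α : ℝ)
    (P : Measure Ω) (δ : ℤ → Ω → Fin d → ℝ) (k : ℤ) (i j : Fin d) : ℝ :=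
  cov[fun ω => gdStationary X y α (fun l => δ l ω) 0 i,
      fun ω => gdStationary X y α (fun l => δ l ω) k j; P]

/-- The long-run covariance matrix `Σ(α) = ∑_{k ∈ ℤ} Cov(β°_0, β°_k)`, for fixed `y`. -/
def longRunCov (X : Matrix (Fin m) (Fin d) ℝ) (y : EuclideanSpace ℝ (Fin m)) (α : ℝ)
    (P : Measure Ω) (δ : ℤ → Ω → Fin d → ℝ) : Matrix (Fin d) (Fin d) ℝ :=
  Matrix.of fun i j => ∑' k : ℤ, stationaryCov X y α P δ k i j

/-- The data `y = X β* + ε` of the linear model. -/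
def response (X : Matrix (Fin m) (Fin d) ℝ) (βstar : EuclideanSpace ℝ (Fin d))
    (ε : EuclideanSpace ℝ (Fin m)) : EuclideanSpace ℝ (Fin m) :=
  Matrix.toEuclideanLin X βstar + ε

end

end GDDropout

/-! A gradient step is an affine map $b\mapsto A_Db+c_D$ with $A_D=I-\alpha D\mathbb XD$ symmetric,
and $D$ takes finitely many values. Since $\|A_Dv\|^2\le\|v\|^2-\alpha(2-\alpha\|\mathbb
X\|)\|XDv\|^2$ and $\mathbb E\|XDv\|^2=p\,v^\top\mathbb X_pv\ge p(1-p)\min_j\mathbb X_{jj}\|v\|^2$,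
the linear part never expands and contracts in mean square (`norm_stepLin_sq_le`,
`rescaled_gram_lower_bound`, `exists_affineSystem`). Everything else about the recursion is proved
for abstract random affine maps with these properties.

Increments of the backward compositions decay geometrically in $L^1$, hence are almost surely
summable (`ae_tendsto_backwardIter`). The limits form a stationary process with finite fourth
moments, and any stationary law must be their common law (`isStationaryProcess_stationaryIter`,
`eq_map_stationaryIter`).

The central limit theorem is proved by characteristic functions after centring at $\tilde\beta$,
where the offset has mean zero. Let $B=\mathbb E A_D$ and $z-Bz=u$. Then $\langle u,e_{k+1}\rangle$
is a martingale difference, the innovation, plus the telescoping term $\langle Bz,e_k\rangle-\langle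
Bz,e_{k+1}\rangle$. A quadratic corrector $g$ solves the Poisson equation whose right side is half
the conditional variance of the innovation minus a constant $\sigma$ (`exists_corrector`). With the
factor $1+\theta^2g$, the expected exponential is multiplied at each step by $1-\theta^2\sigma$ up
to $O(\theta^3)$ (`exists_one_step`). Taking $\theta=n^{-1/2}$ gives the limit $e^{-\sigma}$
(`tendsto_integral_exp_partial_sum`).

It remains to see that $2\sigma=u^\top\Sigma u$. Autocovariances are second moments against $B^nb$,
so their series telescopes (`hasSum_integral_mul`); integrating the Poisson equation against the
stationary law gives the same value (`two_mul_corrector_const`). Part (B) follows because, by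
independence, conditioning on $y$ amounts to freezing $y$ (`condDistrib_ae_eq_map_of_indepFun`). -/

namespace RandomAffine

/-! ### I.i.d. inputs, averaging over one input, forward and backward iterates. -/

noncomputable section

set_option linter.unusedSectionVars false

variable {Ω S E 𝓨 : Type*} [mΩ : MeasurableSpace Ω] [mS : MeasurableSpace S]

/-- A sequence of i.i.d. inputs with values in a finite alphabet `T`, the letter `s` having
probability `w s`. -/
structure IIDInput (P : Measure Ω) (x : ℤ → Ω → S) (T : Finset S) (w : S → ℝ) : Prop where
  meas : ∀ k, Measurable (x k)
  indep : iIndepFun x P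
  ae_mem : ∀ k, ∀ᵐ ω ∂P, x k ω ∈ T
  prob : ∀ k, ∀ s ∈ T, P.real (x k ⁻¹' {s}) = w s

/-- The `σ`-algebra generated by the inputs with index in `L`. -/
abbrev inputSigma (x : ℤ → Ω → S) (L : Set ℤ) : MeasurableSpace Ω :=
  ⨆ l ∈ L, mS.comap (x l)

lemma inputSigma_le {x : ℤ → Ω → S} (hx : ∀ k, Measurable (x k)) (L : Set ℤ) :
    inputSigma x L ≤ mΩ :=
  iSup₂_le fun l _ => (hx l).comap_le

lemma measurable_inputSigma (x : ℤ → Ω → S) {L : Set ℤ} {l : ℤ} (hl : l ∈ L) :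
    Measurable[inputSigma x L] (x l) :=
  Measurable.mono (comap_measurable (x l)) (le_iSup₂_of_le l hl le_rfl) le_rfl

/-- Disjoint blocks of an independent family generate independent $\sigma$-algebras. Independence of
an iterate from an input it has not used is always obtained here. -/
lemma indepFun_of_measurable_inputSigma [MeasurableSpace 𝓨] {P : Measure Ω} {x : ℤ → Ω → S}
    (hx : ∀ k, Measurable (x k)) (hind : iIndepFun x P) {L : Set ℤ} {k : ℤ} (hk : k ∉ L)
    {Y : Ω → 𝓨} (hY : Measurable[inputSigma x L] Y) : IndepFun Y (x k) P := by
  rw [iIndepFun_iff_iIndep] at hind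
  have h := indep_iSup_of_disjoint (fun l => (hx l).comap_le) hind
    (S := L) (T := {k}) (by simpa using hk)
  rw [IndepFun_iff_Indep]
  refine indep_of_indep_of_le_left (indep_of_indep_of_le_right h ?_) hY.comap_le
  exact le_iSup₂_of_le k rfl le_rfl

section Integral

variable {P : Measure Ω} [IsProbabilityMeasure P] {x : ℤ → Ω → S} {T : Finset S} {w : S → ℝ}
  [MeasurableSingletonClass S] [MeasurableSpace 𝓨]

lemma IIDInput.weight_nonneg (h : IIDInput P x T w) {s : S} (hs : s ∈ T) : 0 ≤ w s := by
  rw [← h.prob 0 s hs]; exact measureReal_nonneg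

/-- Averaging out an input which is independent of `Y`. -/
lemma IIDInput.integral_eq {𝕜 : Type*} [RCLike 𝕜] (h : IIDInput P x T w) {Y : Ω → 𝓨} {k : ℤ}
    (hind : IndepFun Y (x k) P) {F : 𝓨 → S → 𝕜} (hF : ∀ s, Measurable fun y => F y s)
    (hint : ∀ s ∈ T, Integrable (fun ω => F (Y ω) s) P) :
    Integrable (fun ω => F (Y ω) (x k ω)) P ∧
      ∫ ω, F (Y ω) (x k ω) ∂P = ∫ ω, ∑ s ∈ T, (w s : 𝕜) * F (Y ω) s ∂P := by
  classical
  have hms (s : S) : MeasurableSet (x k ⁻¹' {s}) := h.meas k (measurableSet_singleton s)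
  let I (s : S) : S → 𝕜 := Set.indicator {s} 1
  have hI (s : S) : Measurable (I s) :=
    measurable_one.indicator (measurableSet_singleton s)
  have hIx (s : S) : (fun ω => I s (x k ω)) = (x k ⁻¹' {s}).indicator 1 := by
    ext ω; simp [I, Set.indicator_apply, Pi.single_apply]
  have hIint (s : S) : Integrable (fun ω => I s (x k ω)) P := by
    rw [hIx]; exact (integrable_const (1 : 𝕜)).indicator (hms s)
  have hindI (s : S) : IndepFun (fun ω => F (Y ω) s) (fun ω => I s (x k ω)) P :=
    hind.comp (hF s) (hI s)
  -- Splitting over the finitely many letters makes each term a product of a function of `Y` and an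
  -- indicator of `x k`, whose expectation factors.
  have hae : (fun ω => F (Y ω) (x k ω)) =ᵐ[P]
      fun ω => ∑ s ∈ T, F (Y ω) s * I s (x k ω) := by
    filter_upwards [h.ae_mem k] with ω hω
    rw [Finset.sum_eq_single_of_mem _ hω]
    · simp [I]
    · intro b _ hb
      simp [I, hb.symm]
  have hi (s : S) (hs : s ∈ T) : Integrable (fun ω => F (Y ω) s * I s (x k ω)) P :=
    (hindI s).integrable_mul (hint s hs) (hIint s)
  refine ⟨(integrable_congr hae).2 (integrable_finsetSum _ hi), ?_⟩
  rw [integral_congr_ae hae, integral_finsetSum _ hi,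
    integral_finsetSum _ fun s hs => (hint s hs).const_mul _]
  refine Finset.sum_congr rfl fun s hs => ?_
  rw [(hindI s).integral_fun_mul_eq_mul_integral (hint s hs).1 (hIint s).1, hIx,
    integral_const_mul, ← h.prob k s hs, mul_comm, Pi.one_def, integral_indicator_const _ (hms s)]
  simp [RCLike.real_smul_eq_coe_mul]

end Integral

section Iterates

/-- The forward iteration `e_{k+1} = f_{x_{k+1}}(e_k)`. -/
def forwardIter (f : S → E → E) (x : ℤ → S) (e : E) : ℕ → E
  | 0 => e
  | k + 1 => f (x ((k : ℤ) + 1)) (forwardIter f x e k)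

/-- The backward composition `f_{x_k} ∘ ⋯ ∘ f_{x_{k-j}}`. -/
def backwardIter (f : S → E → E) (x : ℤ → S) (k : ℤ) : ℕ → E → E
  | 0, e => f (x k) e
  | j + 1, e => backwardIter f x k j (f (x (k - ((j : ℤ) + 1))) e)

/-- The definition adds the oldest map on the inside. Peeling off the newest map on the outside
instead exposes an input independent of all that it acts on. -/
lemma backwardIter_succ' (f : S → E → E) (x : ℤ → S) (k : ℤ) (j : ℕ) (e : E) :
    backwardIter f x k (j + 1) e = f (x k) (backwardIter f x (k - 1) j e) := by
  induction j generalizing e with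
  | zero => simp [backwardIter]
  | succ j ih =>
    rw [backwardIter, ih, backwardIter]
    congr 4
    push_cast; ring

variable [MeasurableSpace E] {f : S → E → E}

lemma measurable_forwardIter (hf : Measurable fun z : S × E => f z.1 z.2) (x : ℤ → Ω → S)
    {L : Set ℤ} (e : E) (n : ℕ) (hL : ∀ i : ℤ, 1 ≤ i → i ≤ n → i ∈ L) :
    Measurable[inputSigma x L] fun ω => forwardIter f (fun l => x l ω) e n := by
  induction n with
  | zero => exact measurable_const
  | succ n ih =>
    have h1 := ih fun i h1 h2 => hL i h1 (by push_cast; lia)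
    have h2 := measurable_inputSigma x (hL (n + 1) (by lia) (by push_cast; lia))
    exact hf.comp (h2.prodMk h1)

lemma measurable_backwardIter (hf : Measurable fun z : S × E => f z.1 z.2) (x : ℤ → Ω → S)
    {L : Set ℤ} {Y : Ω → E} (hY : Measurable[inputSigma x L] Y) (k : ℤ) (j : ℕ)
    (hL : ∀ i : ℤ, k - j ≤ i → i ≤ k → i ∈ L) :
    Measurable[inputSigma x L] fun ω => backwardIter f (fun l => x l ω) k j (Y ω) := by
  induction j generalizing Y with
  | zero =>
    exact hf.comp ((measurable_inputSigma x (hL k (by simp) le_rfl)).prodMk hY)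
  | succ j ih =>
    refine ih (Y := fun ω => f (x (k - ((j : ℤ) + 1)) ω) (Y ω)) ?_
      fun i h1 h2 => hL i (by push_cast; lia) h2
    exact hf.comp ((measurable_inputSigma x (hL _ (by push_cast; lia) (by lia))).prodMk hY)

end Iterates

end

end RandomAffine

/-! ### Mean contraction and uniform fourth moments. -/

namespace RandomAffine

noncomputable section

set_option linter.unusedSectionVars false

variable {Ω S E : Type*} [mΩ : MeasurableSpace Ω] [mS : MeasurableSpace S]
  [MeasurableSingletonClass S]
  [NormedAddCommGroup E] [InnerProductSpace ℝ E] [FiniteDimensional ℝ E] [MeasurableSpace E]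
  [BorelSpace E]

/-- The affine map `e ↦ A_s e + c_s`. -/
def affineStep (A : S → E →L[ℝ] E) (c : S → E) (s : S) (e : E) : E := A s e + c s

/-- A random affine map whose linear part is nonexpansive and contracts in mean square. -/
structure AffineSystem (T : Finset S) (w : S → ℝ) (A : S → E →L[ℝ] E) (c : S → E) (r : ℝ) :
    Prop where
  weight_nonneg : ∀ s ∈ T, 0 ≤ w s
  weight_sum : ∑ s ∈ T, w s = 1
  r_nonneg : 0 ≤ r
  r_lt_one : r < 1
  norm_le : ∀ s ∈ T, ∀ v, ‖A s v‖ ≤ ‖v‖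
  contract : ∀ v, ∑ s ∈ T, w s * ‖A s v‖ ^ 2 ≤ r * ‖v‖ ^ 2
  meas : Measurable fun z : S × E => affineStep A c z.1 z.2

variable {T : Finset S} {w : S → ℝ} {A : S → E →L[ℝ] E} {c : S → E} {r : ℝ}

namespace AffineSystem

lemma meas_linear (h : AffineSystem T w A c r) : Measurable fun z : S × E => A z.1 z.2 := by
  have h0 : Measurable fun z : S × E => affineStep A c z.1 0 :=
    h.meas.comp (measurable_fst.prodMk measurable_const)
  have := h.meas.sub h0
  convert this using 2 with z
  simp [affineStep]

/-- Jensen's inequality for the square. -/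
lemma sum_norm_le (h : AffineSystem T w A c r) (v : E) :
    ∑ s ∈ T, w s * ‖A s v‖ ≤ √r * ‖v‖ := by
  have h1 := (Even.convexOn_pow (𝕜 := ℝ) even_two).map_sum_le (t := T) (w := w)
    (p := fun s => ‖A s v‖) h.weight_nonneg h.weight_sum fun _ _ => Set.mem_univ _
  simp only [smul_eq_mul] at h1
  refine (le_abs_self _).trans (abs_le_of_sq_le_sq (h1.trans ?_) (by positivity))
  rw [mul_pow, Real.sq_sqrt h.r_nonneg]
  exact h.contract v

lemma sqrt_lt_one (h : AffineSystem T w A c r) : √r < 1 := by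
  rw [Real.sqrt_lt' one_pos]; simpa using h.r_lt_one

lemma exists_norm_offset_le (T : Finset S) (c : S → E) : ∃ κ, 0 ≤ κ ∧ ∀ s ∈ T, ‖c s‖ ≤ κ :=
  ⟨∑ s ∈ T, ‖c s‖, by positivity, fun s hs =>
    Finset.single_le_sum (f := fun s => ‖c s‖) (fun _ _ => norm_nonneg _) hs⟩

/-- The weighted inequality for squares, used twice. The factor of $a^4$ can be taken arbitrarily
close to $1$, so that adding the offset does not spoil a contraction. -/
lemma add_pow_four_le {t : ℝ} (ht : 0 < t) (a b : ℝ) :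
    (a + b) ^ 4 ≤ (1 + t) ^ 3 * a ^ 4 + (1 + 1 / t) ^ 3 * b ^ 4 := by
  have key (a b : ℝ) : (a + b) ^ 2 ≤ (1 + t) * a ^ 2 + (1 + 1 / t) * b ^ 2 := by
    have : 0 ≤ (t * a - b) ^ 2 / t := by positivity
    have e : (t * a - b) ^ 2 / t = t * a ^ 2 - 2 * a * b + 1 / t * b ^ 2 := by
      field_simp; ring
    nlinarith
  calc (a + b) ^ 4 = ((a + b) ^ 2) ^ 2 := by ring
    _ ≤ ((1 + t) * a ^ 2 + (1 + 1 / t) * b ^ 2) ^ 2 := by gcongr; exact key a b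
    _ ≤ (1 + t) * ((1 + t) * a ^ 2) ^ 2 + (1 + 1 / t) * ((1 + 1 / t) * b ^ 2) ^ 2 := key _ _
    _ = _ := by ring

/-- The drift condition for the fourth power of the norm. -/
lemma exists_drift (h : AffineSystem T w A c r) : ∃ ρ C : ℝ, 0 ≤ ρ ∧ ρ < 1 ∧ 0 ≤ C ∧
    ∀ e, ∑ s ∈ T, w s * ‖affineStep A c s e‖ ^ 4 ≤ ρ * ‖e‖ ^ 4 + C := by
  obtain ⟨κ, hκ0, hκ⟩ := exists_norm_offset_le T c
  obtain ⟨t, ht0, ht⟩ : ∃ t : ℝ, 0 < t ∧ (1 + t) ^ 3 * r < 1 := by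
    have hcont : Tendsto (fun t : ℝ => (1 + t) ^ 3 * r) (𝓝[>] 0) (𝓝 ((1 + 0) ^ 3 * r)) :=
      (Continuous.tendsto (by fun_prop) 0).mono_left nhdsWithin_le_nhds
    have := hcont.eventually (gt_mem_nhds (by simpa using h.r_lt_one : (1 + (0 : ℝ)) ^ 3 * r < 1))
    obtain ⟨t, h1, h2⟩ := (this.and self_mem_nhdsWithin).exists
    exact ⟨t, h2, h1⟩
  have hr := h.r_nonneg
  refine ⟨(1 + t) ^ 3 * r, (1 + 1 / t) ^ 3 * κ ^ 4, by positivity, ht, by positivity,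
    fun e => ?_⟩
  have hs (s) (hs : s ∈ T) : w s * ‖affineStep A c s e‖ ^ 4 ≤
      (1 + t) ^ 3 * ‖e‖ ^ 2 * (w s * ‖A s e‖ ^ 2) + w s * ((1 + 1 / t) ^ 3 * κ ^ 4) := by
    have hw := h.weight_nonneg s hs
    have h1 : ‖affineStep A c s e‖ ≤ ‖A s e‖ + κ :=
      (norm_add_le _ _).trans (by gcongr; exact hκ s hs)
    -- Two of the four powers are spent on nonexpansiveness; the other two are left for the
    -- mean-square contraction.
    have h2 : ‖A s e‖ ^ 4 ≤ ‖e‖ ^ 2 * ‖A s e‖ ^ 2 := by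
      have : ‖A s e‖ ^ 4 = ‖A s e‖ ^ 2 * ‖A s e‖ ^ 2 := by ring
      rw [this]; gcongr; exact h.norm_le s hs e
    calc w s * ‖affineStep A c s e‖ ^ 4 ≤ w s * (‖A s e‖ + κ) ^ 4 := by gcongr
      _ ≤ w s * ((1 + t) ^ 3 * ‖A s e‖ ^ 4 + (1 + 1 / t) ^ 3 * κ ^ 4) := by
        gcongr; exact add_pow_four_le ht0 _ _
      _ ≤ w s * ((1 + t) ^ 3 * (‖e‖ ^ 2 * ‖A s e‖ ^ 2) + (1 + 1 / t) ^ 3 * κ ^ 4) := by gcongr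
      _ = _ := by ring
  refine (Finset.sum_le_sum hs).trans ?_
  rw [Finset.sum_add_distrib, ← Finset.mul_sum, ← Finset.sum_mul, h.weight_sum, one_mul]
  have := h.contract e
  calc _ ≤ (1 + t) ^ 3 * ‖e‖ ^ 2 * (r * ‖e‖ ^ 2) + (1 + 1 / t) ^ 3 * κ ^ 4 := by gcongr
    _ = _ := by ring

end AffineSystem

/-- By Tonelli the sum of the norms has finite expectation, hence is almost surely finite. -/
lemma ae_summable_norm {P : Measure Ω} {F : ℕ → Ω → E} (hF : ∀ n, Integrable (F n) P)
    (hs : Summable fun n => ∫ ω, ‖F n ω‖ ∂P) : ∀ᵐ ω ∂P, Summable fun n => ‖F n ω‖ := by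
  have h1 : ∑' n, ∫⁻ ω, ‖F n ω‖ₑ ∂P ≠ ⊤ := by
    have (n : ℕ) : ∫⁻ ω, ‖F n ω‖ₑ ∂P = ENNReal.ofReal (∫ ω, ‖F n ω‖ ∂P) := by
      rw [ofReal_integral_norm_eq_lintegral_enorm (hF n)]
    simp_rw [this]
    exact hs.tsum_ofReal_ne_top
  rw [← lintegral_tsum fun n => (hF n).1.enorm] at h1
  filter_upwards [ae_lt_top' (AEMeasurable.tsum fun n => (hF n).1.enorm) h1] with ω hω
  have := ENNReal.summable_toReal hω.ne
  simpa using this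

section Random

variable {P : Measure Ω} [IsProbabilityMeasure P] {x : ℤ → Ω → S}

lemma AffineSystem.integrable_norm_step (h : AffineSystem T w A c r) {Y : Ω → E}
    (hY : Measurable Y) (hint : Integrable (fun ω => ‖Y ω‖ ^ 4) P) {s : S} (hs : s ∈ T) :
    Integrable (fun ω => ‖affineStep A c s (Y ω)‖ ^ 4) P := by
  have hm : Measurable fun y => ‖affineStep A c s y‖ ^ 4 :=
    ((h.meas.comp (measurable_const.prodMk measurable_id)).norm).pow_const 4
  refine Integrable.mono' ((hint.const_mul ((1 + 1) ^ 3)).add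
    (integrable_const ((1 + 1 / 1) ^ 3 * ‖c s‖ ^ 4))) (hm.comp hY).aestronglyMeasurable
    (ae_of_all _ fun ω => ?_)
  rw [Real.norm_of_nonneg (by positivity)]
  have h1 : ‖affineStep A c s (Y ω)‖ ≤ ‖Y ω‖ + ‖c s‖ :=
    (norm_add_le _ _).trans (by gcongr; exact h.norm_le s hs _)
  calc _ ≤ (‖Y ω‖ + ‖c s‖) ^ 4 := by gcongr
    _ ≤ _ := AffineSystem.add_pow_four_le one_pos _ _

lemma fourth_moment_step (h : AffineSystem T w A c r) (hx : IIDInput P x T w) {ρ C : ℝ}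
    (hd : ∀ e, ∑ s ∈ T, w s * ‖affineStep A c s e‖ ^ 4 ≤ ρ * ‖e‖ ^ 4 + C)
    {Y : Ω → E} (hY : Measurable Y) {k : ℤ} (hind : IndepFun Y (x k) P)
    (hint : Integrable (fun ω => ‖Y ω‖ ^ 4) P) :
    Integrable (fun ω => ‖affineStep A c (x k ω) (Y ω)‖ ^ 4) P ∧
      ∫ ω, ‖affineStep A c (x k ω) (Y ω)‖ ^ 4 ∂P ≤ ρ * ∫ ω, ‖Y ω‖ ^ 4 ∂P + C := by
  have hm (s : S) : Measurable fun y => ‖affineStep A c s y‖ ^ 4 :=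
    ((h.meas.comp (measurable_const.prodMk measurable_id)).norm).pow_const 4
  have hi (s : S) (hs : s ∈ T) := h.integrable_norm_step hY hint hs
  obtain ⟨h1, h2⟩ := hx.integral_eq hind (F := fun y s => ‖affineStep A c s y‖ ^ 4) hm hi
  refine ⟨h1, ?_⟩
  rw [h2]
  calc _ ≤ ∫ ω, (ρ * ‖Y ω‖ ^ 4 + C) ∂P :=
        integral_mono (integrable_finsetSum _ fun s hs => (hi s hs).const_mul _)
          ((hint.const_mul _).add (integrable_const _)) fun ω => hd (Y ω)
    _ = _ := by rw [integral_add (hint.const_mul _) (integrable_const _), integral_const_mul]; simp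

lemma norm_moment_step (h : AffineSystem T w A c r) (hx : IIDInput P x T w)
    {Y : Ω → E} (hY : Measurable Y) {k : ℤ} (hind : IndepFun Y (x k) P)
    (hint : Integrable Y P) :
    Integrable (fun ω => A (x k ω) (Y ω)) P ∧
      ∫ ω, ‖A (x k ω) (Y ω)‖ ∂P ≤ √r * ∫ ω, ‖Y ω‖ ∂P := by
  have hm (s : S) : Measurable fun y => ‖A s y‖ := by fun_prop
  have hi (s : S) (hs : s ∈ T) : Integrable (fun ω => ‖A s (Y ω)‖) P :=
    ((A s).integrable_comp hint).norm
  obtain ⟨h1, h2⟩ := hx.integral_eq hind (F := fun y s => ‖A s y‖) hm hi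
  have hmeas : Measurable fun ω => A (x k ω) (Y ω) := h.meas_linear.comp ((hx.meas k).prodMk hY)
  refine ⟨(integrable_norm_iff hmeas.aestronglyMeasurable).1 h1, ?_⟩
  rw [h2, ← integral_const_mul]
  exact integral_mono (integrable_finsetSum _ fun s hs => (hi s hs).const_mul _)
          (hint.norm.const_mul _) fun ω => h.sum_norm_le (Y ω)

/-- The bound $M=\|e\|^4+C/(1-\rho)$ dominates the starting value and satisfies $\rho M+C\le M$, so
the drift inequality preserves it whenever an independent input is applied last. -/
lemma exists_fourth_moment_bound (h : AffineSystem T w A c r) (hx : IIDInput P x T w) (e : E) :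
    ∃ M : ℝ, 0 ≤ M ∧
      (∀ n, Integrable (fun ω => ‖forwardIter (affineStep A c) (fun l => x l ω) e n‖ ^ 4) P ∧
        ∫ ω, ‖forwardIter (affineStep A c) (fun l => x l ω) e n‖ ^ 4 ∂P ≤ M) ∧
      ∀ k j, Integrable (fun ω => ‖backwardIter (affineStep A c) (fun l => x l ω) k j e‖ ^ 4) P ∧
        ∫ ω, ‖backwardIter (affineStep A c) (fun l => x l ω) k j e‖ ^ 4 ∂P ≤ M := by
  obtain ⟨ρ, C, hρ0, hρ1, hC, hd⟩ := h.exists_drift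
  have hρ : 0 < 1 - ρ := by linarith
  set M := ‖e‖ ^ 4 + C / (1 - ρ) with hM
  have heM : ‖e‖ ^ 4 ≤ M := by rw [hM]; have : 0 ≤ C / (1 - ρ) := by positivity
                               linarith
  have hstep : ρ * M + C ≤ M := by
    have : M = ρ * M + C + (1 - ρ) * ‖e‖ ^ 4 := by rw [hM]; field_simp; ring
    have h2 : 0 ≤ (1 - ρ) * ‖e‖ ^ 4 := by positivity
    linarith
  refine ⟨M, by positivity, fun n => ?_, fun k j => ?_⟩
  · induction n with
    | zero => simpa [forwardIter] using heM
    | succ n ih =>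
      have hY := measurable_forwardIter (L := {l | l ≤ n}) h.meas x e n fun i _ h2 => h2
      have hind := indepFun_of_measurable_inputSigma hx.meas hx.indep
        (k := (n : ℤ) + 1) (by simp) hY
      have := fourth_moment_step h hx hd (hY.mono (inputSigma_le hx.meas _) le_rfl) hind ih.1
      refine ⟨this.1, this.2.trans (le_trans ?_ hstep)⟩
      gcongr
      exact ih.2
  · induction j generalizing k with
    | zero =>
      have := fourth_moment_step h hx hd (Y := fun _ : Ω => e) measurable_const
        (k := k) (indepFun_const_left _ _) (integrable_const _)
      refine ⟨this.1, this.2.trans (le_trans ?_ hstep)⟩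
      gcongr
      simpa using heM
    | succ j ih =>
      have hY := measurable_backwardIter (L := {l | l < k}) h.meas x
        (measurable_const (a := e)) (k - 1) j fun i _ h2 => by simp; lia
      have hind := indepFun_of_measurable_inputSigma hx.meas hx.indep
        (k := k) (by simp) hY
      have := fourth_moment_step h hx hd (hY.mono (inputSigma_le hx.meas _) le_rfl) hind (ih _).1
      simp_rw [backwardIter_succ']
      refine ⟨this.1, this.2.trans (le_trans ?_ hstep)⟩
      gcongr
      exact (ih _).2

end Random

end

end RandomAffine

/-! ### Backward limits, the stationary process and uniqueness of the stationary law. -/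

namespace RandomAffine

noncomputable section

set_option linter.unusedSectionVars false

variable {Ω S E : Type*} [mΩ : MeasurableSpace Ω] [mS : MeasurableSpace S]
  [MeasurableSingletonClass S]
  [NormedAddCommGroup E] [InnerProductSpace ℝ E] [FiniteDimensional ℝ E] [MeasurableSpace E]
  [BorelSpace E]

/-- The limit of the backward compositions started at `0`. -/
def stationaryIter (f : S → E → E) (x : ℤ → S) (k : ℤ) : E :=
  limUnder atTop fun j : ℕ => backwardIter f x k j 0

variable {T : Finset S} {w : S → ℝ} {A : S → E →L[ℝ] E} {c : S → E} {r : ℝ}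

lemma exists_linear_backwardIter (A : S → E →L[ℝ] E) (x : ℤ → S) (k : ℤ) (j : ℕ) :
    ∃ L : E →ₗ[ℝ] E, ∀ v, backwardIter (fun s v => A s v) x k j v = L v := by
  induction j with
  | zero => exact ⟨A (x k), fun v => rfl⟩
  | succ j ih =>
    obtain ⟨L, hL⟩ := ih
    exact ⟨L ∘ₗ (A (x (k - ((j : ℤ) + 1)))), fun v => by rw [backwardIter, hL]; rfl⟩

/-- Under common inputs the offsets cancel, so dependence on the starting point is governed by the
linear parts alone. -/
lemma backwardIter_sub (A : S → E →L[ℝ] E) (c : S → E) (x : ℤ → S) (k : ℤ) (j : ℕ) (e e' : E) :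
    backwardIter (affineStep A c) x k j e - backwardIter (affineStep A c) x k j e' =
      backwardIter (fun s v => A s v) x k j (e - e') := by
  induction j generalizing k with
  | zero => simp [backwardIter, affineStep]
  | succ j ih =>
    rw [backwardIter_succ', backwardIter_succ', backwardIter_succ', ← ih]
    simp [affineStep]

lemma measurable_stationaryIter {f : S → E → E} (hf : Measurable fun z : S × E => f z.1 z.2)
    (x : ℤ → Ω → S) (k : ℤ) :
    Measurable[inputSigma x {l | l ≤ k}] fun ω => stationaryIter f (fun l => x l ω) k := by
  -- The past becomes the ambient $\sigma$-algebra, so that the limit is measurable with respect to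
  -- it and not merely on `Ω`.
  let _ : MeasurableSpace Ω := inputSigma x {l | l ≤ k}
  refine (StronglyMeasurable.limUnder fun j => ?_).measurable
  exact Measurable.stronglyMeasurable <|
    measurable_backwardIter hf x (measurable_const (a := (0 : E))) k j fun i _ h => h

variable {P : Measure Ω} [IsProbabilityMeasure P] {x : ℤ → Ω → S}

/-- `L¹`-decay along the backward iteration. -/
lemma backward_decay (h : AffineSystem T w A c r) (hx : IIDInput P x T w)
    {W : ℤ → ℕ → Ω → E} (hmeas : ∀ k j, Measurable[inputSigma x {l | l ≤ k}] (W k j))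
    (hsucc : ∀ k j ω, W k (j + 1) ω = A (x k ω) (W (k - 1) j ω)) {M : ℝ}
    (h0 : ∀ k, ∀ᵐ ω ∂P, ‖W k 0 ω‖ ≤ M) (k : ℤ) (j : ℕ) :
    Integrable (W k j) P ∧ ∫ ω, ‖W k j ω‖ ∂P ≤ M * √r ^ j := by
  induction j generalizing k with
  | zero =>
    have hi : Integrable (W k 0) P := Integrable.of_bound
      ((hmeas k 0).mono (inputSigma_le hx.meas _) le_rfl).aestronglyMeasurable M (h0 k)
    refine ⟨hi, ?_⟩
    calc _ ≤ ∫ _, M ∂P := integral_mono_ae hi.norm (integrable_const _) (h0 k)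
      _ = _ := by simp
  | succ j ih =>
    -- `W (k - 1) j` uses no input after time `k - 1`, so `x k` contributes an independent factor
    -- $\sqrt r$.
    have hind := indepFun_of_measurable_inputSigma hx.meas hx.indep
      (k := k) (by simp) (hmeas (k - 1) j)
    have := norm_moment_step h hx ((hmeas (k - 1) j).mono (inputSigma_le hx.meas _) le_rfl) hind
      (ih _).1
    rw [funext (hsucc k j)]
    refine ⟨this.1, this.2.trans ?_⟩
    calc _ ≤ √r * (M * √r ^ j) := by gcongr; exact (ih _).2
      _ = _ := by ring

lemma backward_ae_summable (h : AffineSystem T w A c r) (hx : IIDInput P x T w)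
    {W : ℤ → ℕ → Ω → E} (hmeas : ∀ k j, Measurable[inputSigma x {l | l ≤ k}] (W k j))
    (hsucc : ∀ k j ω, W k (j + 1) ω = A (x k ω) (W (k - 1) j ω)) {M : ℝ}
    (h0 : ∀ k, ∀ᵐ ω ∂P, ‖W k 0 ω‖ ≤ M) (k : ℤ) :
    ∀ᵐ ω ∂P, Summable fun j => ‖W k j ω‖ := by
  have hd := backward_decay h hx hmeas hsucc h0 k
  refine ae_summable_norm (fun j => (hd j).1) ?_
  refine Summable.of_nonneg_of_le (fun j => by positivity) (fun j => (hd j).2) ?_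
  exact (summable_geometric_of_lt_one (by positivity) h.sqrt_lt_one).mul_left M

/-- The backward compositions converge almost surely, uniformly in the starting point. -/
theorem ae_tendsto_backwardIter (h : AffineSystem T w A c r) (hx : IIDInput P x T w) (k : ℤ) :
    ∀ᵐ ω ∂P, ∀ e, Tendsto (fun j => backwardIter (affineStep A c) (fun l => x l ω) k j e) atTop
      (𝓝 (stationaryIter (affineStep A c) (fun l => x l ω) k)) := by
  obtain ⟨κ, hκ0, hκ⟩ := AffineSystem.exists_norm_offset_le T c
  have hzero : ∀ᵐ ω ∂P, Tendsto
      (fun j => backwardIter (affineStep A c) (fun l => x l ω) k j 0) atTop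
      (𝓝 (stationaryIter (affineStep A c) (fun l => x l ω) k)) := by
    have hm (k : ℤ) (j : ℕ) : Measurable[inputSigma x {l | l ≤ k}]
        fun ω => backwardIter (affineStep A c) (fun l => x l ω) k j 0 :=
      measurable_backwardIter h.meas x (measurable_const (a := (0 : E))) k j fun i _ h => h
    -- Successive differences evolve linearly, and the first one is the linear part at time `k`
    -- applied to the offset at time `k - 1`, of norm at most `κ`.
    have := backward_ae_summable h hx (M := κ)
      (W := fun k j ω => backwardIter (affineStep A c) (fun l => x l ω) k (j + 1) 0 -
        backwardIter (affineStep A c) (fun l => x l ω) k j 0)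
      (fun k j => (hm k (j + 1)).sub (hm k j))
      (fun k j ω => by
        rw [backwardIter_succ' _ _ k (j + 1), backwardIter_succ' _ _ k j]
        simp [affineStep])
      (fun k => by
        filter_upwards [hx.ae_mem k, hx.ae_mem (k - 1)] with ω h1 h2
        simp only [backwardIter, affineStep]
        simpa using (h.norm_le _ h1 _).trans (hκ _ h2)) k
    filter_upwards [this] with ω hω
    have hc : CauchySeq fun j => backwardIter (affineStep A c) (fun l => x l ω) k j 0 := by
      refine cauchySeq_of_summable_dist ?_
      simpa [dist_eq_norm, norm_sub_rev] using hω
    exact hc.tendsto_limUnder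
  -- Finitely many basis vectors suffice by linearity, which gives one null set for all starting
  -- points.
  let b := Module.finBasis ℝ E
  have hlin : ∀ᵐ ω ∂P, ∀ i, Tendsto
      (fun j => backwardIter (fun s v => A s v) (fun l => x l ω) k j (b i)) atTop (𝓝 0) := by
    rw [ae_all_iff]
    intro i
    have := backward_ae_summable h hx (M := ‖b i‖)
      (W := fun k j ω => backwardIter (fun s v => A s v) (fun l => x l ω) k j (b i))
      (fun k j => measurable_backwardIter h.meas_linear x (measurable_const (a := b i)) k j
        fun i _ h => h)
      (fun k j ω => backwardIter_succ' _ _ _ _ _)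
      (fun k => by
        filter_upwards [hx.ae_mem k] with ω h1
        exact h.norm_le _ h1 _) k
    filter_upwards [this] with ω hω
    exact tendsto_zero_iff_norm_tendsto_zero.2 hω.tendsto_atTop_zero
  filter_upwards [hzero, hlin] with ω h1 h2 e
  have h3 : Tendsto (fun j => backwardIter (fun s v => A s v) (fun l => x l ω) k j e) atTop
      (𝓝 0) := by
    have : Tendsto (fun j => ∑ i, b.repr e i •
        backwardIter (fun s v => A s v) (fun l => x l ω) k j (b i)) atTop
        (𝓝 (∑ i, b.repr e i • (0 : E))) :=
      tendsto_finsetSum _ fun i _ => (h2 i).const_smul _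
    simp only [smul_zero, Finset.sum_const_zero] at this
    refine this.congr fun j => ?_
    obtain ⟨L, hL⟩ := exists_linear_backwardIter A (fun l => x l ω) k j
    simp_rw [hL, ← map_smul, ← map_sum, b.sum_repr]
  have h4 := h1.add h3
  rw [add_zero] at h4
  refine h4.congr fun j => ?_
  have := backwardIter_sub A c (fun l => x l ω) k j e 0
  rw [sub_zero] at this
  rw [← this]; abel

/-- The data of a stationary version of the recursion driven by `x`. -/
structure IsStationaryProcess (P : Measure Ω) (x : ℤ → Ω → S) (A : S → E →L[ℝ] E) (c : S → E)
    (Z : ℤ → Ω → E) : Prop where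
  meas : ∀ k, Measurable (Z k)
  memLp : ∀ k, MemLp (Z k) 4 P
  step : ∀ k, ∀ᵐ ω ∂P, Z k ω = affineStep A c (x k ω) (Z (k - 1) ω)
  indep : ∀ l k : ℤ, l ≤ k → IndepFun (fun ω => (Z l ω, Z k ω)) (x (k + 1)) P
  map_eq : ∀ k l, P.map (Z k) = P.map (Z l)

/-- Peel off the newest map and pass to the limit through it by continuity. -/
lemma stationaryIter_step (h : AffineSystem T w A c r) (hx : IIDInput P x T w) (k : ℤ) :
    ∀ᵐ ω ∂P, stationaryIter (affineStep A c) (fun l => x l ω) k =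
      affineStep A c (x k ω) (stationaryIter (affineStep A c) (fun l => x l ω) (k - 1)) := by
  filter_upwards [ae_tendsto_backwardIter h hx k, ae_tendsto_backwardIter h hx (k - 1)]
    with ω h1 h2
  refine tendsto_nhds_unique ((tendsto_add_atTop_iff_nat 1).2 (h1 0)) ?_
  simp_rw [backwardIter_succ']
  have hc : Continuous (affineStep A c (x k ω)) := by unfold affineStep; fun_prop
  exact (hc.tendsto _).comp (h2 0)

/-- Fatou's lemma applied to the fourth-moment bound, uniform in `j`. -/
lemma memLp_stationaryIter (h : AffineSystem T w A c r) (hx : IIDInput P x T w) (k : ℤ) :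
    MemLp (fun ω => stationaryIter (affineStep A c) (fun l => x l ω) k) 4 P := by
  obtain ⟨M, hM0, -, hM⟩ := exists_fourth_moment_bound h hx 0
  have hm (j : ℕ) : Measurable fun ω => backwardIter (affineStep A c) (fun l => x l ω) k j 0 :=
    (measurable_backwardIter (L := Set.univ) h.meas x (measurable_const (a := (0 : E))) k j
      fun i _ h => trivial).mono (inputSigma_le hx.meas _) le_rfl
  refine ⟨((measurable_stationaryIter h.meas x k).mono (inputSigma_le hx.meas _)
    le_rfl).aestronglyMeasurable, ?_⟩
  have hbound (j : ℕ) : eLpNorm (fun ω => backwardIter (affineStep A c) (fun l => x l ω) k j 0)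
      4 P ≤ ENNReal.ofReal (M ^ (1 / 4 : ℝ)) := by
    have hmem : MemLp (fun ω => backwardIter (affineStep A c) (fun l => x l ω) k j 0) 4 P := by
      rw [← integrable_norm_rpow_iff (hm j).aestronglyMeasurable (by simp) (by simp)]
      simpa using (hM k j).1
    rw [hmem.eLpNorm_eq_integral_rpow_norm (by simp) (by simp)]
    refine ENNReal.ofReal_le_ofReal ?_
    simp only [ENNReal.toReal_ofNat, Real.rpow_ofNat, one_div]
    exact Real.rpow_le_rpow (by positivity) (hM k j).2 (by norm_num)
  refine (Lp.eLpNorm_lim_le_liminf_eLpNorm (fun j => (hm j).aestronglyMeasurable) _ ?_).trans_lt ?_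
  · filter_upwards [ae_tendsto_backwardIter h hx k] with ω hω using hω 0
  · refine lt_of_le_of_lt (Filter.liminf_le_of_le (f := atTop) (by isBoundedDefault)
      (a := ENNReal.ofReal (M ^ (1 / 4 : ℝ))) fun b hb => ?_) ENNReal.ofReal_lt_top
    obtain ⟨j, hj⟩ := hb.exists
    exact hj.trans (hbound j)

/-- Averaging out the oldest input shows that, as a function of `e`, the expectation gains one
application of the transition operator when `j` grows by one. -/
lemma integral_backwardIter_succ (h : AffineSystem T w A c r) (hx : IIDInput P x T w)
    (g : BoundedContinuousFunction E ℝ) (k : ℤ) (j : ℕ) (e : E) :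
    ∫ ω, g (backwardIter (affineStep A c) (fun l => x l ω) k (j + 1) e) ∂P =
      ∑ s ∈ T, w s *
        ∫ ω, g (backwardIter (affineStep A c) (fun l => x l ω) k j (affineStep A c s e)) ∂P := by
  set n : ℤ := k - ((j : ℤ) + 1) with hn
  have hm (s : S) : Measurable[inputSigma x {l | l ≠ n}] fun ω =>
      backwardIter (affineStep A c) (fun l => x l ω) k j (affineStep A c s e) :=
    measurable_backwardIter h.meas x (measurable_const (a := affineStep A c s e)) k j
      fun i h1 _ => by simp; lia
  -- The values for all letters are bundled into one random function, so that a single independence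
  -- statement covers whichever letter is drawn.
  have hYm : Measurable[inputSigma x {l | l ≠ n}] fun ω s =>
      backwardIter (affineStep A c) (fun l => x l ω) k j (affineStep A c s e) :=
    (@measurable_pi_iff _ _ _ (inputSigma x {l | l ≠ n}) _ _).2 hm
  have hind := indepFun_of_measurable_inputSigma hx.meas hx.indep (k := n) (by simp) hYm
  have hi (s : S) : Integrable
      (fun ω => g (backwardIter (affineStep A c) (fun l => x l ω) k j (affineStep A c s e))) P :=
    Integrable.of_bound (g.continuous.measurable.comp
      ((hm s).mono (inputSigma_le hx.meas _) le_rfl)).aestronglyMeasurable ‖g‖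
      (ae_of_all _ fun ω => g.norm_coe_le_norm _)
  have := (hx.integral_eq hind (F := fun (y : S → E) s => g (y s))
    (fun s => g.continuous.measurable.comp (measurable_pi_apply s)) fun s _ => hi s).2
  simp only [backwardIter]
  rw [this, integral_finsetSum _ fun s _ => (hi s).const_mul _]
  simp_rw [integral_const_mul]
  rfl

lemma integral_backwardIter_zero (h : AffineSystem T w A c r) (hx : IIDInput P x T w)
    (g : BoundedContinuousFunction E ℝ) (k : ℤ) (e : E) :
    ∫ ω, g (backwardIter (affineStep A c) (fun l => x l ω) k 0 e) ∂P =
      ∑ s ∈ T, w s * g (affineStep A c s e) := by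
  have := (hx.integral_eq (indepFun_const_left e (x k)) (F := fun y s => g (affineStep A c s y))
    (fun s => g.continuous.measurable.comp (h.meas.comp (measurable_const.prodMk measurable_id)))
    fun s _ => integrable_const _).2
  simp only [backwardIter]
  rw [this]
  simp

/-- Both sides obey the same recursion in `j`, and its weights do not involve the time index. -/
lemma integral_backwardIter_eq (h : AffineSystem T w A c r) (hx : IIDInput P x T w)
    (g : BoundedContinuousFunction E ℝ) (k l : ℤ) (j : ℕ) (e : E) :
    ∫ ω, g (backwardIter (affineStep A c) (fun i => x i ω) k j e) ∂P =
      ∫ ω, g (backwardIter (affineStep A c) (fun i => x i ω) l j e) ∂P := by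
  induction j generalizing e with
  | zero => rw [integral_backwardIter_zero h hx, integral_backwardIter_zero h hx]
  | succ j ih => simp_rw [integral_backwardIter_succ h hx, ih]

lemma tendsto_integral_backwardIter (h : AffineSystem T w A c r) (hx : IIDInput P x T w)
    (g : BoundedContinuousFunction E ℝ) (k : ℤ) (e : E) :
    Tendsto (fun j => ∫ ω, g (backwardIter (affineStep A c) (fun l => x l ω) k j e) ∂P) atTop
      (𝓝 (∫ ω, g (stationaryIter (affineStep A c) (fun l => x l ω) k) ∂P)) := by
  refine tendsto_integral_of_dominated_convergence (fun _ => ‖g‖) (fun j => ?_)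
    (integrable_const _) (fun j => ae_of_all _ fun ω => g.norm_coe_le_norm _) ?_
  · exact (g.continuous.measurable.comp ((measurable_backwardIter (L := Set.univ) h.meas x
      (measurable_const (a := e)) k j fun i _ h => trivial).mono
      (inputSigma_le hx.meas _) le_rfl)).aestronglyMeasurable
  · filter_upwards [ae_tendsto_backwardIter h hx k] with ω hω
    exact (g.continuous.tendsto _).comp (hω e)

/-- The almost sure limits of the backward compositions form a stationary process. -/
theorem isStationaryProcess_stationaryIter (h : AffineSystem T w A c r) (hx : IIDInput P x T w) :
    IsStationaryProcess P x A c
      fun k ω => stationaryIter (affineStep A c) (fun l => x l ω) k := by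
  have hm (k : ℤ) : Measurable fun ω => stationaryIter (affineStep A c) (fun l => x l ω) k :=
    (measurable_stationaryIter h.meas x k).mono (inputSigma_le hx.meas _) le_rfl
  refine ⟨hm, memLp_stationaryIter h hx, stationaryIter_step h hx, fun l k hlk => ?_,
    fun k l => ?_⟩
  · have hmono {l : ℤ} (hl : l ≤ k) : Measurable[inputSigma x {i | i ≤ k}]
        fun ω => stationaryIter (affineStep A c) (fun i => x i ω) l :=
      (measurable_stationaryIter h.meas x l).mono
        (biSup_mono fun i (hi : i ≤ l) => hi.trans hl) le_rfl
    exact indepFun_of_measurable_inputSigma hx.meas hx.indep (k := k + 1) (by simp)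
      ((hmono hlk).prodMk (hmono le_rfl))
  · have := Measure.isProbabilityMeasure_map (μ := P) (hm k).aemeasurable
    have := Measure.isProbabilityMeasure_map (μ := P) (hm l).aemeasurable
    refine ext_of_forall_integral_eq_of_IsFiniteMeasure fun g => ?_
    rw [integral_map (hm k).aemeasurable g.continuous.aestronglyMeasurable,
      integral_map (hm l).aemeasurable g.continuous.aestronglyMeasurable]
    refine tendsto_nhds_unique (tendsto_integral_backwardIter h hx g k 0) ?_
    simp_rw [integral_backwardIter_eq h hx g k l]
    exact tendsto_integral_backwardIter h hx g l 0

/-- The law of the limit of the backward compositions is the only stationary law. -/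
theorem eq_map_stationaryIter (h : AffineSystem T w A c r) (hx : IIDInput P x T w)
    {π : Measure E} [IsProbabilityMeasure π]
    (hπ : ∀ g : E → ℝ, Measurable g → (∃ C, ∀ e, ‖g e‖ ≤ C) →
      ∫ e, ∑ s ∈ T, w s * g (affineStep A c s e) ∂π = ∫ e, g e ∂π) (k : ℤ) :
    π = P.map (fun ω => stationaryIter (affineStep A c) (fun l => x l ω) k) := by
  have hm := (isStationaryProcess_stationaryIter h hx).meas k
  have := Measure.isProbabilityMeasure_map (μ := P) hm.aemeasurable
  refine ext_of_forall_integral_eq_of_IsFiniteMeasure fun g => ?_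
  rw [integral_map hm.aemeasurable g.continuous.aestronglyMeasurable]
  -- Invariance of `π` makes the `π`-integral of `U j` constant in `j`, while `U j` converges
  -- boundedly to a number independent of `e`.
  let U (j : ℕ) (e : E) : ℝ :=
    ∫ ω, g (backwardIter (affineStep A c) (fun l => x l ω) k j e) ∂P
  have hUb (j : ℕ) (e : E) : ‖U j e‖ ≤ ‖g‖ := by
    refine (norm_integral_le_of_norm_le_const (ae_of_all _ fun ω => g.norm_coe_le_norm _)).trans ?_
    simp
  have hstep (s : S) : Measurable (affineStep A c s) :=
    h.meas.comp (measurable_const.prodMk measurable_id)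
  have hUm (j : ℕ) : Measurable (U j) := by
    induction j with
    | zero =>
      simp_rw [U, integral_backwardIter_zero h hx]
      exact Finset.measurable_sum _ fun s _ =>
        (g.continuous.measurable.comp (hstep s)).const_mul _
    | succ j ih =>
      simp_rw [U, integral_backwardIter_succ h hx]
      exact Finset.measurable_sum _ fun s _ => (ih.comp (hstep s)).const_mul _
  have hUint (j : ℕ) : ∫ e, U j e ∂π = ∫ e, g e ∂π := by
    induction j with
    | zero =>
      simp_rw [U, integral_backwardIter_zero h hx]
      exact hπ g g.continuous.measurable ⟨‖g‖, g.norm_coe_le_norm⟩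
    | succ j ih =>
      simp_rw [U, integral_backwardIter_succ h hx]
      rw [← ih]
      exact hπ (U j) (hUm j) ⟨‖g‖, hUb j⟩
  have hlim : Tendsto (fun j => ∫ e, U j e ∂π) atTop (𝓝 (∫ _,
      (∫ ω, g (stationaryIter (affineStep A c) (fun l => x l ω) k) ∂P) ∂π)) :=
    tendsto_integral_of_dominated_convergence (fun _ => ‖g‖)
      (fun j => (hUm j).aestronglyMeasurable) (integrable_const _)
      (fun j => ae_of_all _ (hUb j))
      (ae_of_all _ fun e => tendsto_integral_backwardIter h hx g k e)
  simp_rw [hUint] at hlim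
  simpa using tendsto_nhds_unique tendsto_const_nhds hlim

end

end RandomAffine

/-! ### Poisson equations and the quadratic corrector. -/

namespace RandomAffine

noncomputable section

set_option linter.unusedSectionVars false

open scoped RealInnerProductSpace

variable {Ω S E : Type*} [mΩ : MeasurableSpace Ω] [mS : MeasurableSpace S]
  [MeasurableSingletonClass S]
  [NormedAddCommGroup E] [InnerProductSpace ℝ E] [FiniteDimensional ℝ E] [MeasurableSpace E]
  [BorelSpace E]

lemma exists_sub_apply_eq {V : Type*} [AddCommGroup V] [Module ℝ V] [FiniteDimensional ℝ V]
    (L : V →ₗ[ℝ] V) (hL : ∀ v, v = L v → v = 0) (v : V) : ∃ u, u - L u = v := by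
  have hinj : Function.Injective (LinearMap.id - L : V →ₗ[ℝ] V) := by
    refine (injective_iff_map_eq_zero _).2 fun a ha => hL a ?_
    simpa [sub_eq_zero] using ha
  obtain ⟨u, hu⟩ := LinearMap.surjective_of_injective hinj v
  exact ⟨u, by simpa using hu⟩

variable {T : Finset S} {w : S → ℝ} {A : S → E →L[ℝ] E} {c : S → E} {r : ℝ}

/-- The mean `∑ w_s A_s` of the linear parts. -/
def meanMap (T : Finset S) (w : S → ℝ) (A : S → E →L[ℝ] E) : E →L[ℝ] E := ∑ s ∈ T, w s • A s

lemma meanMap_apply (e : E) : meanMap T w A e = ∑ s ∈ T, w s • A s e := by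
  simp [meanMap]

namespace AffineSystem

lemma norm_meanMap_le (h : AffineSystem T w A c r) (e : E) :
    ‖meanMap T w A e‖ ≤ √r * ‖e‖ := by
  rw [meanMap_apply]
  refine (norm_sum_le _ _).trans (le_trans (Finset.sum_le_sum fun s hs => ?_) (h.sum_norm_le e))
  rw [norm_smul, Real.norm_of_nonneg (h.weight_nonneg s hs)]

/-- The mean map shrinks norms by $\sqrt r<1$, so it has no nonzero fixed vector; in finite
dimension this gives solvability. -/
lemma exists_sub_meanMap_eq (h : AffineSystem T w A c r) (u : E) :
    ∃ z, z - meanMap T w A z = u := by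
  refine exists_sub_apply_eq (meanMap T w A : E →ₗ[ℝ] E) (fun v hv => ?_) u
  have h1 : ‖v‖ ≤ √r * ‖v‖ := by
    conv_lhs => rw [hv]
    exact h.norm_meanMap_le v
  have h2 := h.sqrt_lt_one
  refine norm_le_zero_iff.1 ?_
  nlinarith

/-- The action `β ↦ E β(A·, A·)` on bilinear forms. -/
def bilinMean (T : Finset S) (w : S → ℝ) (A : S → E →L[ℝ] E) :
    (E →L[ℝ] E →L[ℝ] ℝ) →ₗ[ℝ] (E →L[ℝ] E →L[ℝ] ℝ) where
  toFun β := ∑ s ∈ T, w s • β.bilinearComp (A s) (A s)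
  map_add' β γ := by
    ext u v; simp [mul_add, Finset.sum_add_distrib]
  map_smul' a β := by
    ext u v; simp [Finset.mul_sum, mul_left_comm]

lemma bilinMean_apply (β : E →L[ℝ] E →L[ℝ] ℝ) (u v : E) :
    bilinMean T w A β u v = ∑ s ∈ T, w s * β (A s u) (A s v) := by
  simp [bilinMean]

/-- Cauchy–Schwarz with the weights split as $\sqrt{w_s}\sqrt{w_s}$. It makes the averaged action on
bilinear forms a contraction of factor `r`. -/
lemma sum_norm_mul_norm_le (h : AffineSystem T w A c r) (u v : E) :
    ∑ s ∈ T, w s * (‖A s u‖ * ‖A s v‖) ≤ r * (‖u‖ * ‖v‖) := by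
  have hr := h.r_nonneg
  refine (le_abs_self _).trans (abs_le_of_sq_le_sq ?_ (by positivity))
  have h1 := Finset.sum_mul_sq_le_sq_mul_sq T (fun s => √(w s) * ‖A s u‖)
    (fun s => √(w s) * ‖A s v‖)
  have e1 : ∑ s ∈ T, √(w s) * ‖A s u‖ * (√(w s) * ‖A s v‖) =
      ∑ s ∈ T, w s * (‖A s u‖ * ‖A s v‖) := Finset.sum_congr rfl fun s hs => by
    calc _ = (√(w s) * √(w s)) * (‖A s u‖ * ‖A s v‖) := by ring
      _ = _ := by rw [Real.mul_self_sqrt (h.weight_nonneg s hs)]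
  have e2 (u : E) : ∑ s ∈ T, (√(w s) * ‖A s u‖) ^ 2 = ∑ s ∈ T, w s * ‖A s u‖ ^ 2 :=
    Finset.sum_congr rfl fun s hs => by rw [mul_pow, Real.sq_sqrt (h.weight_nonneg s hs)]
  rw [e1, e2, e2] at h1
  refine h1.trans ?_
  calc _ ≤ (r * ‖u‖ ^ 2) * (r * ‖v‖ ^ 2) := by
        gcongr
        · exact Finset.sum_nonneg fun s hs => mul_nonneg (h.weight_nonneg s hs) (by positivity)
        · exact h.contract u
        · exact h.contract v
    _ = _ := by ring

lemma exists_sub_bilinMean_eq (h : AffineSystem T w A c r) (β₀ : E →L[ℝ] E →L[ℝ] ℝ) :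
    ∃ β, β - bilinMean T w A β = β₀ := by
  refine exists_sub_apply_eq (bilinMean T w A) (fun β hβ => ?_) β₀
  have h1 : ‖β‖ ≤ r * ‖β‖ := by
    have hr := h.r_nonneg
    refine ContinuousLinearMap.opNorm_le_bound₂ _ (by positivity) fun u v => ?_
    conv_lhs => rw [hβ, bilinMean_apply]
    refine (norm_sum_le _ _).trans ?_
    calc _ ≤ ∑ s ∈ T, w s * (‖A s u‖ * ‖A s v‖) * ‖β‖ := by
          refine Finset.sum_le_sum fun s hs => ?_
          have hw := h.weight_nonneg s hs
          rw [norm_mul, Real.norm_of_nonneg hw, mul_assoc]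
          gcongr
          calc _ ≤ ‖β‖ * ‖A s u‖ * ‖A s v‖ := β.le_opNorm₂ _ _
            _ = _ := by ring
      _ = (∑ s ∈ T, w s * (‖A s u‖ * ‖A s v‖)) * ‖β‖ := by rw [Finset.sum_mul]
      _ ≤ r * (‖u‖ * ‖v‖) * ‖β‖ := by gcongr; exact h.sum_norm_mul_norm_le u v
      _ = _ := by ring
  have h2 := h.r_lt_one
  have h3 : ‖β‖ ≤ 0 := by nlinarith
  ext u v
  have h4 := β.le_opNorm₂ u v
  have h5 : ‖β‖ * ‖u‖ * ‖v‖ ≤ 0 := mul_nonpos_of_nonpos_of_nonneg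
    (mul_nonpos_of_nonpos_of_nonneg h3 (norm_nonneg u)) (norm_nonneg v)
  simpa using norm_le_zero_iff.1 (h4.trans h5)

/-- The Poisson equation for quadratic functions. -/
lemma exists_poisson (h : AffineSystem T w A c r)
    (hsymm : ∀ s ∈ T, ∀ u v, ⟪A s u, v⟫ = ⟪u, A s v⟫)
    (β₀ : E →L[ℝ] E →L[ℝ] ℝ) (ℓ₀ : E →L[ℝ] ℝ) :
    ∃ (β : E →L[ℝ] E →L[ℝ] ℝ) (b : E) (σ : ℝ), ∀ e,
      ∑ s ∈ T, w s * (β (affineStep A c s e) (affineStep A c s e) + ⟪b, affineStep A c s e⟫) -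
        (β e e + ⟪b, e⟫) = β₀ e e + ℓ₀ e - σ := by
  -- The unknowns are found by degree: `β` settles the quadratic part (the sign is reversed because
  -- the equation has mean minus identity), `b` absorbs the cross terms `ℓ` created by the offset,
  -- and the constants left over define `σ`.
  obtain ⟨β, hβ⟩ := h.exists_sub_bilinMean_eq (-β₀)
  let ℓ : E →L[ℝ] ℝ := ∑ s ∈ T, w s • ((β.flip (c s)) ∘L A s + (β (c s)) ∘L A s)
  obtain ⟨b, hb⟩ := h.exists_sub_meanMap_eq ((InnerProductSpace.toDual ℝ E).symm (ℓ - ℓ₀))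
  refine ⟨β, b, -∑ s ∈ T, w s * (β (c s) (c s) + ⟪b, c s⟫), fun e => ?_⟩
  have h1 : β e e - ∑ s ∈ T, w s * β (A s e) (A s e) = - β₀ e e := by
    rw [← bilinMean_apply]
    exact congrArg (fun γ : E →L[ℝ] E →L[ℝ] ℝ => γ e e) hβ
  have h2 : ⟪b, e⟫ - ∑ s ∈ T, w s * ⟪b, A s e⟫ =
      (∑ s ∈ T, w s * (β (A s e) (c s) + β (c s) (A s e))) - ℓ₀ e := by
    have e1 : ⟪meanMap T w A b, e⟫ = ∑ s ∈ T, w s * ⟪b, A s e⟫ := by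
      rw [meanMap_apply, sum_inner]
      exact Finset.sum_congr rfl fun s hs => by rw [real_inner_smul_left, hsymm s hs]
    rw [← e1, ← inner_sub_left, hb, InnerProductSpace.toDual_symm_apply]
    simp [ℓ, mul_add]
  have h3 : ∑ s ∈ T, w s *
      (β (affineStep A c s e) (affineStep A c s e) + ⟪b, affineStep A c s e⟫) =
      ∑ s ∈ T, w s * β (A s e) (A s e) +
      ∑ s ∈ T, w s * (β (A s e) (c s) + β (c s) (A s e)) + ∑ s ∈ T, w s * ⟪b, A s e⟫ +
      ∑ s ∈ T, w s * (β (c s) (c s) + ⟪b, c s⟫) := by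
    simp_rw [← Finset.sum_add_distrib]
    refine Finset.sum_congr rfl fun s _ => ?_
    simp only [affineStep, map_add, add_apply, inner_add_right]
    ring
  rw [h3]
  linarith

/-- The martingale difference in direction `z`. -/
def innov (T : Finset S) (w : S → ℝ) (A : S → E →L[ℝ] E) (c : S → E) (z : E) (s : S) (e : E) : ℝ :=
  ⟪z, affineStep A c s e⟫ - ⟪meanMap T w A z, e⟫

/-- Symmetry of the linear parts turns $\langle Bz,e\rangle$ into the mean of $\langle
z,A_se\rangle$, and the offset has mean zero. This martingale property removes the first-order term
in the expansion below. -/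
lemma sum_innov (h : AffineSystem T w A c r)
    (hsymm : ∀ s ∈ T, ∀ u v, ⟪A s u, v⟫ = ⟪u, A s v⟫) (hc : ∑ s ∈ T, w s • c s = 0) (z e : E) :
    ∑ s ∈ T, w s * innov T w A c z s e = 0 := by
  have e1 : ⟪meanMap T w A z, e⟫ = ∑ s ∈ T, w s * ⟪z, A s e⟫ := by
    rw [meanMap_apply, sum_inner]
    exact Finset.sum_congr rfl fun s hs => by rw [real_inner_smul_left, hsymm s hs]
  have e2 : ∑ s ∈ T, w s * ⟪z, c s⟫ = 0 := by
    simp_rw [← real_inner_smul_right]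
    rw [← inner_sum, hc, inner_zero_right]
  simp only [innov, affineStep, inner_add_right, mul_sub, mul_add, Finset.sum_sub_distrib,
    Finset.sum_add_distrib]
  rw [← Finset.sum_mul, h.weight_sum, e1, e2]
  ring

/-- A solution of the Poisson equation for half the conditional variance of the innovation. -/
lemma exists_corrector (h : AffineSystem T w A c r)
    (hsymm : ∀ s ∈ T, ∀ u v, ⟪A s u, v⟫ = ⟪u, A s v⟫) (z : E) :
    ∃ (g : E → ℝ) (σ C : ℝ), Continuous g ∧ 0 ≤ C ∧ (∀ e, |g e| ≤ C * (1 + ‖e‖) ^ 2) ∧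
      ∀ e, ∑ s ∈ T, w s * g (affineStep A c s e) - g e =
        (∑ s ∈ T, w s * innov T w A c z s e ^ 2) / 2 - σ := by
  -- The innovation is `φ s e` plus the constant $\langle z,c_s\rangle$. Half its squared mean
  -- supplies the quadratic and linear data below; its constant part is added to `σ`.
  let φ (s : S) : E →L[ℝ] ℝ := (innerSL ℝ z) ∘L A s - innerSL ℝ (meanMap T w A z)
  obtain ⟨β, b, σ, hβ⟩ := h.exists_poisson hsymm
    ((1 / 2 : ℝ) • ∑ s ∈ T, w s • (φ s).smulRight (φ s))
    (∑ s ∈ T, (w s * ⟪z, c s⟫) • φ s)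
  refine ⟨fun e => β e e + ⟪b, e⟫, σ + (∑ s ∈ T, w s * ⟪z, c s⟫ ^ 2) / 2, ‖β‖ + ‖b‖,
    by fun_prop, by positivity, fun e => ?_, fun e => ?_⟩
  · calc _ ≤ |β e e| + |⟪b, e⟫| := abs_add_le _ _
      _ ≤ ‖β‖ * ‖e‖ * ‖e‖ + ‖b‖ * ‖e‖ :=
        add_le_add (β.le_opNorm₂ e e) (abs_real_inner_le_norm b e)
      _ ≤ _ := by nlinarith [norm_nonneg β, norm_nonneg b, norm_nonneg e,
                  mul_nonneg (norm_nonneg β) (norm_nonneg e),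
                  mul_nonneg (norm_nonneg b) (norm_nonneg e),
                  mul_nonneg (mul_nonneg (norm_nonneg b) (norm_nonneg e)) (norm_nonneg e)]
  · rw [hβ]
    have hi (s : S) : innov T w A c z s e = φ s e + ⟪z, c s⟫ := by
      simp [innov, affineStep, φ, inner_add_right]; ring
    simp_rw [hi]
    simp only [smul_apply, sum_apply,
      ContinuousLinearMap.smulRight_apply, smul_eq_mul]
    have : ∑ s ∈ T, w s * (φ s e + ⟪z, c s⟫) ^ 2 = ∑ s ∈ T, w s * (φ s e * φ s e) +
        2 * ∑ s ∈ T, w s * ⟪z, c s⟫ * φ s e + ∑ s ∈ T, w s * ⟪z, c s⟫ ^ 2 := by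
      rw [Finset.mul_sum, ← Finset.sum_add_distrib, ← Finset.sum_add_distrib]
      exact Finset.sum_congr rfl fun s _ => by ring
    rw [this]
    ring

end AffineSystem

/-- For $|x|\le1$ this is the tail of the exponential series. For $|x|>1$ the triangle inequality
gives $2+|x|+x^2/2$, which is below $4|x|^3$. -/
lemma norm_cexp_sub_taylor_le (x : ℝ) :
    ‖Complex.exp (Complex.I * x) - (1 + Complex.I * x - x ^ 2 / 2)‖ ≤ 4 * |x| ^ 3 := by
  have hn : ‖Complex.I * (x : ℂ)‖ = |x| := by simp
  rcases le_or_gt |x| 1 with hx | hx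
  · have h1 := Complex.exp_bound (x := Complex.I * x) (by rw [hn]; exact hx) (n := 3) (by norm_num)
    rw [hn] at h1
    have e : ∑ m ∈ Finset.range 3, (Complex.I * (x : ℂ)) ^ m / (m.factorial : ℂ) =
        1 + Complex.I * x - x ^ 2 / 2 := by
      simp [Finset.sum_range_succ, Nat.factorial, mul_pow]; ring
    rw [e] at h1
    refine h1.trans ?_
    rw [mul_comm]
    gcongr
    norm_num [Nat.factorial]
  · have h0 : ‖Complex.exp (Complex.I * x)‖ = 1 := by
      rw [mul_comm]; exact Complex.norm_exp_ofReal_mul_I x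
    have h2 : ‖(x : ℂ) ^ 2 / 2‖ = |x| ^ 2 / 2 := by simp
    calc _ ≤ ‖Complex.exp (Complex.I * x)‖ + (‖(1 : ℂ)‖ + ‖Complex.I * (x : ℂ)‖ + ‖(x : ℂ) ^ 2 / 2‖) :=
          (norm_sub_le _ _).trans (add_le_add le_rfl ((norm_sub_le _ _).trans
            (add_le_add (norm_add_le _ _) le_rfl)))
      _ = 1 + (1 + |x| + |x| ^ 2 / 2) := by rw [h0, hn, h2]; simp
      _ ≤ _ := by
        have : 1 ≤ |x| ^ 2 := by nlinarith
        nlinarith [mul_pos (zero_lt_one.trans hx) (zero_lt_one.trans hx)]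

end

end RandomAffine

/-! ### Characteristic functions of normalized partial sums. -/

namespace RandomAffine

noncomputable section

set_option linter.unusedSectionVars false

open scoped RealInnerProductSpace

variable {Ω S E : Type*} [mΩ : MeasurableSpace Ω] [mS : MeasurableSpace S]
  [MeasurableSingletonClass S]
  [NormedAddCommGroup E] [InnerProductSpace ℝ E] [FiniteDimensional ℝ E] [MeasurableSpace E]
  [BorelSpace E]

variable {T : Finset S} {w : S → ℝ} {A : S → E →L[ℝ] E} {c : S → E} {r : ℝ}

lemma one_add_pow_le {m : ℕ} (hm : m ≤ 4) {a : ℝ} (ha : 0 ≤ a) :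
    (1 + a) ^ m ≤ 8 * (1 + a ^ 4) := by
  calc (1 + a) ^ m ≤ (1 + a) ^ 4 := pow_le_pow_right₀ (by linarith) hm
    _ ≤ (1 + 1) ^ 3 * 1 ^ 4 + (1 + 1 / 1) ^ 3 * a ^ 4 :=
      AffineSystem.add_pow_four_le one_pos 1 a
    _ = _ := by ring

namespace AffineSystem

/-- The exponential test function, corrected to second order. -/
def testFun (z : E) (g : E → ℝ) (θ : ℝ) (e : E) : ℂ :=
  Complex.exp (Complex.I * (θ * ⟪z, e⟫ : ℝ)) * (1 + θ ^ 2 * g e : ℝ)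

/-- One-step expansion of the corrected exponential. -/
lemma exists_one_step (h : AffineSystem T w A c r)
    (hsymm : ∀ s ∈ T, ∀ u v, ⟪A s u, v⟫ = ⟪u, A s v⟫) (hc : ∑ s ∈ T, w s • c s = 0) (z : E)
    {g : E → ℝ} {σ C : ℝ} (hC : 0 ≤ C) (hgC : ∀ e, |g e| ≤ C * (1 + ‖e‖) ^ 2)
    (hg : ∀ e, ∑ s ∈ T, w s * g (affineStep A c s e) - g e =
        (∑ s ∈ T, w s * innov T w A c z s e ^ 2) / 2 - σ) :
    ∃ K, 0 ≤ K ∧ ∀ θ : ℝ, 0 ≤ θ → θ ≤ 1 → ∀ e,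
      ‖∑ s ∈ T, (w s : ℂ) * (Complex.exp (Complex.I * (θ * innov T w A c z s e : ℝ)) *
          (1 + θ ^ 2 * g (affineStep A c s e) : ℝ)) -
        (((1 - θ ^ 2 * σ) * (1 + θ ^ 2 * g e) : ℝ) : ℂ)‖ ≤ K * θ ^ 3 * (1 + ‖e‖ ^ 4) := by
  obtain ⟨κ, hκ0, hκ⟩ := exists_norm_offset_le T c
  set a := ‖z‖ * (1 + κ) + ‖meanMap T w A z‖ with ha
  set b := C * (1 + κ) ^ 2 with hb
  have ha0 : 0 ≤ a := by positivity
  have hb0 : 0 ≤ b := by positivity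
  refine ⟨8 * (4 * a ^ 3 + a * b + |σ| * C), by positivity, fun θ hθ0 hθ1 e => ?_⟩
  set m := 1 + ‖e‖ with hm
  have hm1 : 1 ≤ m := by have := norm_nonneg e; linarith
  have hstep (s) (hs : s ∈ T) : ‖affineStep A c s e‖ ≤ ‖e‖ + κ :=
    (norm_add_le _ _).trans (add_le_add (h.norm_le s hs e) (hκ s hs))
  have hD (s) (hs : s ∈ T) : |innov T w A c z s e| ≤ a * m := by
    calc |innov T w A c z s e| ≤ |⟪z, affineStep A c s e⟫| + |⟪meanMap T w A z, e⟫| := abs_sub _ _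
      _ ≤ ‖z‖ * ‖affineStep A c s e‖ + ‖meanMap T w A z‖ * ‖e‖ :=
        add_le_add (abs_real_inner_le_norm _ _) (abs_real_inner_le_norm _ _)
      _ ≤ ‖z‖ * ((1 + κ) * m) + ‖meanMap T w A z‖ * m := by
        gcongr
        · refine (hstep s hs).trans ?_
          nlinarith [norm_nonneg e]
        · linarith
      _ = a * m := by rw [ha]; ring
  have hG (s) (hs : s ∈ T) : |g (affineStep A c s e)| ≤ b * m ^ 2 := by
    refine (hgC _).trans ?_
    rw [hb, mul_assoc, ← mul_pow]
    gcongr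
    nlinarith [hstep s hs, norm_nonneg e]
  -- the remainder for one letter
  let R (s : S) : ℂ := Complex.exp (Complex.I * (θ * innov T w A c z s e : ℝ)) *
      (1 + θ ^ 2 * g (affineStep A c s e) : ℝ) -
      (1 + Complex.I * (θ * innov T w A c z s e : ℝ) - (θ * innov T w A c z s e : ℝ) ^ 2 / 2 +
        (θ ^ 2 * g (affineStep A c s e) : ℝ))
  have hR (s) (hs : s ∈ T) : ‖R s‖ ≤ (4 * a ^ 3 + a * b) * θ ^ 3 * m ^ 3 := by
    set D := innov T w A c z s e
    set G := g (affineStep A c s e)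
    -- Both pieces are of third order in `θ`: the Taylor remainder, and a first-order factor times
    -- the second-order corrector.
    have e1 : R s = (Complex.exp (Complex.I * (θ * D : ℝ)) -
        (1 + Complex.I * (θ * D : ℝ) - (θ * D : ℝ) ^ 2 / 2)) +
        (Complex.exp (Complex.I * (θ * D : ℝ)) - 1) * (θ ^ 2 * G : ℝ) := by
      simp only [R]; push_cast; ring
    have e2 : ‖((θ ^ 2 * G : ℝ) : ℂ)‖ = θ ^ 2 * |G| := by
      rw [Complex.norm_real, norm_mul, Real.norm_of_nonneg (by positivity), Real.norm_eq_abs]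
    have e3 : |θ * D| ≤ θ * (a * m) := by
      rw [abs_mul, abs_of_nonneg hθ0]; gcongr; exact hD s hs
    calc ‖R s‖ ≤ 4 * |θ * D| ^ 3 + |θ * D| * (θ ^ 2 * |G|) := by
          rw [e1]
          refine (norm_add_le _ _).trans (add_le_add (norm_cexp_sub_taylor_le _) ?_)
          rw [norm_mul, e2]
          gcongr
          exact Real.norm_exp_I_mul_ofReal_sub_one_le
      _ ≤ 4 * (θ * (a * m)) ^ 3 + θ * (a * m) * (θ ^ 2 * (b * m ^ 2)) := by
          gcongr; exact hG s hs
      _ = _ := by ring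
  -- The first order vanishes by centring. At second order the Poisson equation cancels the
  -- conditional variance and leaves $g(e)-\sigma$.
  have hmain : ∑ s ∈ T, (w s : ℂ) * (1 + Complex.I * (θ * innov T w A c z s e : ℝ) -
      (θ * innov T w A c z s e : ℝ) ^ 2 / 2 + (θ ^ 2 * g (affineStep A c s e) : ℝ)) =
      ((1 + θ ^ 2 * (g e - σ) : ℝ) : ℂ) := by
    have h1 := h.weight_sum
    have h2 := h.sum_innov hsymm hc z e
    have h3 := hg e
    have e1 : ∑ s ∈ T, (w s : ℂ) * (1 + Complex.I * (θ * innov T w A c z s e : ℝ) -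
        (θ * innov T w A c z s e : ℝ) ^ 2 / 2 + (θ ^ 2 * g (affineStep A c s e) : ℝ)) =
        (∑ s ∈ T, w s : ℝ) + Complex.I * θ * (∑ s ∈ T, w s * innov T w A c z s e : ℝ) +
        θ ^ 2 * ((∑ s ∈ T, w s * g (affineStep A c s e) : ℝ) -
          (∑ s ∈ T, w s * innov T w A c z s e ^ 2 : ℝ) / 2) := by
      push_cast
      rw [Finset.mul_sum, Finset.sum_div, ← Finset.sum_sub_distrib, Finset.mul_sum,
        ← Finset.sum_add_distrib, ← Finset.sum_add_distrib]
      exact Finset.sum_congr rfl fun s _ => by ring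
    have h4 : ∑ s ∈ T, w s * g (affineStep A c s e) =
      g e + (∑ s ∈ T, w s * innov T w A c z s e ^ 2) / 2 - σ := by linarith
    rw [e1, h1, h2, h4]
    push_cast; ring
  -- Writing the main term as the product $(1-\theta^2\sigma)(1+\theta^2g)$, which the recursion
  -- requires, costs only $\theta^4\sigma g$.
  have e4 : ∑ s ∈ T, (w s : ℂ) * (Complex.exp (Complex.I * (θ * innov T w A c z s e : ℝ)) *
      (1 + θ ^ 2 * g (affineStep A c s e) : ℝ)) -
        (((1 - θ ^ 2 * σ) * (1 + θ ^ 2 * g e) : ℝ) : ℂ) =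
      ∑ s ∈ T, (w s : ℂ) * R s + ((θ ^ 4 * (σ * g e) : ℝ) : ℂ) := by
    simp only [R, mul_sub (_ : ℂ) (_ * _ : ℂ), Finset.sum_sub_distrib]
    rw [hmain]
    push_cast; ring
  rw [e4]
  have hRsum : ‖∑ s ∈ T, (w s : ℂ) * R s‖ ≤ (4 * a ^ 3 + a * b) * θ ^ 3 * m ^ 3 := by
    refine (norm_sum_le _ _).trans ?_
    calc _ ≤ ∑ s ∈ T, w s * ((4 * a ^ 3 + a * b) * θ ^ 3 * m ^ 3) := by
          refine Finset.sum_le_sum fun s hs => ?_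
          have hw := h.weight_nonneg s hs
          rw [norm_mul, Complex.norm_real, Real.norm_of_nonneg hw]
          gcongr
          exact hR s hs
      _ = _ := by rw [← Finset.sum_mul, h.weight_sum, one_mul]
  have hlast : ‖((θ ^ 4 * (σ * g e) : ℝ) : ℂ)‖ ≤ |σ| * C * θ ^ 3 * m ^ 3 := by
    rw [Complex.norm_real, norm_mul, norm_mul, Real.norm_of_nonneg (by positivity),
      Real.norm_eq_abs, Real.norm_eq_abs]
    calc θ ^ 4 * (|σ| * |g e|) ≤ θ ^ 3 * (|σ| * (C * m ^ 3)) := by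
          gcongr ?_ * (_ * ?_)
          · exact pow_le_pow_of_le_one hθ0 hθ1 (by norm_num)
          · refine (hgC e).trans ?_
            gcongr <;> norm_num
      _ = _ := by ring
  calc _ ≤ (4 * a ^ 3 + a * b) * θ ^ 3 * m ^ 3 + |σ| * C * θ ^ 3 * m ^ 3 :=
        (norm_add_le _ _).trans (add_le_add hRsum hlast)
    _ = (4 * a ^ 3 + a * b + |σ| * C) * θ ^ 3 * m ^ 3 := by ring
    _ ≤ (4 * a ^ 3 + a * b + |σ| * C) * θ ^ 3 * (8 * (1 + ‖e‖ ^ 4)) := by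
        gcongr; exact one_add_pow_le (by norm_num) (norm_nonneg e)
    _ = _ := by ring

lemma norm_testFun_sub_one_le (z : E) {g : E → ℝ} {C : ℝ} (hC : 0 ≤ C)
    (hgC : ∀ e, |g e| ≤ C * (1 + ‖e‖) ^ 2) {θ : ℝ} (hθ0 : 0 ≤ θ) (hθ1 : θ ≤ 1) (e : E) :
    ‖testFun z g θ e - 1‖ ≤ 8 * (‖z‖ + C) * θ * (1 + ‖e‖ ^ 4) := by
  have e1 : testFun z g θ e - 1 = (Complex.exp (Complex.I * (θ * ⟪z, e⟫ : ℝ)) - 1) +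
      Complex.exp (Complex.I * (θ * ⟪z, e⟫ : ℝ)) * (θ ^ 2 * g e : ℝ) := by
    rw [testFun]; push_cast; ring
  have e2 : ‖Complex.exp (Complex.I * (θ * ⟪z, e⟫ : ℝ)) * (θ ^ 2 * g e : ℝ)‖ = θ ^ 2 * |g e| := by
    rw [norm_mul, mul_comm Complex.I, Complex.norm_exp_ofReal_mul_I, Complex.norm_real, norm_mul,
      Real.norm_of_nonneg (by positivity), Real.norm_eq_abs, one_mul]
  have e3 : |θ * ⟪z, e⟫| ≤ θ * (‖z‖ * (1 + ‖e‖) ^ 2) := by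
    rw [abs_mul, abs_of_nonneg hθ0]
    gcongr
    refine (abs_real_inner_le_norm z e).trans ?_
    gcongr
    nlinarith [norm_nonneg e]
  rw [e1]
  calc _ ≤ |θ * ⟪z, e⟫| + θ ^ 2 * |g e| :=
        (norm_add_le _ _).trans (add_le_add Real.norm_exp_I_mul_ofReal_sub_one_le e2.le)
    _ ≤ θ * (‖z‖ * (1 + ‖e‖) ^ 2) + θ * (C * (1 + ‖e‖) ^ 2) := by
        refine add_le_add e3 (mul_le_mul ?_ (hgC e) (abs_nonneg _) hθ0)
        nlinarith
    _ = (‖z‖ + C) * θ * (1 + ‖e‖) ^ 2 := by ring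
    _ ≤ (‖z‖ + C) * θ * (8 * (1 + ‖e‖ ^ 4)) := by
        gcongr; exact one_add_pow_le (by norm_num) (norm_nonneg e)
    _ = _ := by ring

end AffineSystem

/-- Each of the `n` errors is amplified by at most `μ ^ n`. Below `μ ^ n` stays bounded and `δ` is
of order $n^{-3/2}$, so the total is of order $n^{-1/2}$. -/
lemma norm_sub_pow_mul_le {a : ℕ → ℂ} {lam : ℂ} {μ δ : ℝ} (hμ : 1 ≤ μ) (hδ : 0 ≤ δ)
    (hlam : ‖lam‖ ≤ μ) (ha : ∀ k, ‖a (k + 1) - lam * a k‖ ≤ δ) (n : ℕ) :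
    ‖a n - lam ^ n * a 0‖ ≤ n * μ ^ n * δ := by
  induction n with
  | zero => simp
  | succ n ih =>
    have e : a (n + 1) - lam ^ (n + 1) * a 0 =
        (a (n + 1) - lam * a n) + lam * (a n - lam ^ n * a 0) := by ring
    rw [e]
    calc _ ≤ δ + μ * (n * μ ^ n * δ) := by
          refine (norm_add_le _ _).trans (add_le_add (ha n) ?_)
          rw [norm_mul]
          gcongr
      _ ≤ μ ^ (n + 1) * δ + μ * (n * μ ^ n * δ) := by
          gcongr
          exact le_mul_of_one_le_left hδ (one_le_pow₀ hμ)
      _ = _ := by push_cast; ring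

section CLT

variable {P : Measure Ω} [IsProbabilityMeasure P] {x : ℤ → Ω → S}

open AffineSystem

/-- Convergence of the characteristic function of the normalized partial sums. -/
theorem tendsto_integral_exp_partial_sum (h : AffineSystem T w A c r) (hx : IIDInput P x T w)
    (hsymm : ∀ s ∈ T, ∀ u v, ⟪A s u, v⟫ = ⟪u, A s v⟫) (hc : ∑ s ∈ T, w s • c s = 0) {u z : E}
    (hz : z - meanMap T w A z = u)
    {g : E → ℝ} {σ C : ℝ} (hgcont : Continuous g) (hC : 0 ≤ C)
    (hgC : ∀ e, |g e| ≤ C * (1 + ‖e‖) ^ 2)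
    (hg : ∀ e, ∑ s ∈ T, w s * g (affineStep A c s e) - g e =
        (∑ s ∈ T, w s * innov T w A c z s e ^ 2) / 2 - σ) (e₀ : E) :
    Tendsto (fun n : ℕ => ∫ ω, Complex.exp (Complex.I * ((√n)⁻¹ * ∑ k ∈ Finset.range n,
        ⟪u, forwardIter (affineStep A c) (fun l => x l ω) e₀ (k + 1)⟫ : ℝ)) ∂P) atTop
      (𝓝 (Complex.exp (-σ))) := by
  obtain ⟨K, hK0, hK⟩ := h.exists_one_step hsymm hc z hC hgC hg
  obtain ⟨M, hM0, hM, -⟩ := exists_fourth_moment_bound h hx e₀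
  set X : ℕ → Ω → E := fun n ω => forwardIter (affineStep A c) (fun l => x l ω) e₀ n with hX
  set U : ℕ → Ω → ℝ := fun n ω => ∑ k ∈ Finset.range n, ⟪u, X (k + 1) ω⟫ with hU
  have hXm (n k : ℕ) (hk : k ≤ n) : Measurable[inputSigma x {l | l ≤ n}] (X k) :=
    measurable_forwardIter h.meas x e₀ k fun i _ h2 => by simp; lia
  have hUm (n : ℕ) : Measurable[inputSigma x {l | l ≤ n}] (U n) :=
    Finset.measurable_sum _ fun k hk => Measurable.comp (g := fun v : E => ⟪u, v⟫)
      (by fun_prop) (hXm n (k + 1) (by simp at hk; lia))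
  have hXmeas (n : ℕ) : Measurable (X n) := (hXm n n le_rfl).mono (inputSigma_le hx.meas _) le_rfl
  have hUmeas (n : ℕ) : Measurable (U n) := (hUm n).mono (inputSigma_le hx.meas _) le_rfl
  set B := meanMap T w A
  -- At `(U n, X n)` the exponent carries $U_n+\langle Bz,X_n\rangle$, which is the sum of the
  -- innovations up to its initial value, because $u=z-Bz$.
  let Ψ (θ : ℝ) (q : ℝ × E) : ℂ := Complex.exp (Complex.I * (θ * q.1 : ℝ)) * testFun (B z) g θ q.2
  have hΨm (θ : ℝ) : Measurable (Ψ θ) := by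
    have : Continuous (Ψ θ) := by simp only [Ψ, testFun]; fun_prop
    exact this.measurable
  have hnorm1 (a : ℝ) : ‖Complex.exp (Complex.I * a)‖ = 1 := by
    rw [mul_comm]; exact Complex.norm_exp_ofReal_mul_I a
  have hdom {θ : ℝ} (hθ0 : 0 ≤ θ) (hθ1 : θ ≤ 1) (q : ℝ × E) :
      ‖Ψ θ q - Complex.exp (Complex.I * (θ * q.1 : ℝ))‖ ≤
        8 * (‖B z‖ + C) * θ * (1 + ‖q.2‖ ^ 4) := by
    have : Ψ θ q - Complex.exp (Complex.I * (θ * q.1 : ℝ)) =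
      Complex.exp (Complex.I * (θ * q.1 : ℝ)) * (testFun (B z) g θ q.2 - 1) := by
        simp only [Ψ]; ring
    rw [this, norm_mul, hnorm1, one_mul]
    exact norm_testFun_sub_one_le _ hC hgC hθ0 hθ1 _
  have hVint (n : ℕ) : Integrable (fun ω => 1 + ‖X n ω‖ ^ 4) P :=
    (integrable_const _).add (hM n).1
  have hVle (n : ℕ) : ∫ ω, (1 + ‖X n ω‖ ^ 4) ∂P ≤ 1 + M := by
    rw [integral_add (integrable_const _) (hM n).1]
    simpa using (hM n).2
  have hexpint (θ : ℝ) (n : ℕ) :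
      Integrable (fun ω => Complex.exp (Complex.I * (θ * U n ω : ℝ))) P := by
    refine Integrable.of_bound (C := 1) ?_ (ae_of_all _ fun ω => (hnorm1 _).le)
    have : Continuous fun a : ℝ => Complex.exp (Complex.I * (θ * a : ℝ)) := by fun_prop
    exact (this.measurable.comp (hUmeas n)).aestronglyMeasurable
  have hΨint {θ : ℝ} (hθ0 : 0 ≤ θ) (hθ1 : θ ≤ 1) (n : ℕ) :
      Integrable (fun ω => Ψ θ (U n ω, X n ω)) P := by
    have hd : Integrable (fun ω => Ψ θ (U n ω, X n ω) -
        Complex.exp (Complex.I * (θ * U n ω : ℝ))) P := by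
      refine Integrable.mono' ((hVint n).const_mul (8 * (‖B z‖ + C) * θ)) ?_
        (ae_of_all _ fun ω => hdom hθ0 hθ1 _)
      exact ((hΨm θ).comp ((hUmeas n).prodMk (hXmeas n))).aestronglyMeasurable.sub
        (hexpint θ n).1
    refine (hd.add (hexpint θ n)).congr (ae_of_all _ fun ω => ?_)
    simp
  have hrec {θ : ℝ} (hθ0 : 0 ≤ θ) (hθ1 : θ ≤ 1) (n : ℕ) :
      ‖∫ ω, Ψ θ (U (n + 1) ω, X (n + 1) ω) ∂P -
        ((1 - θ ^ 2 * σ : ℝ) : ℂ) * ∫ ω, Ψ θ (U n ω, X n ω) ∂P‖ ≤ K * θ ^ 3 * (1 + M) := by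
    let F (q : ℝ × E) (s : S) : ℂ :=
      Ψ θ (q.1 + ⟪u, affineStep A c s q.2⟫, affineStep A c s q.2)
    have hFm (s : S) : Measurable fun q => F q s := by
      refine (hΨm θ).comp ?_
      have : Measurable (affineStep A c s) := h.meas.comp (measurable_const.prodMk measurable_id)
      have h2 : Measurable fun q : ℝ × E => affineStep A c s q.2 := this.comp measurable_snd
      have h3 : Measurable fun v : E => ⟪u, v⟫ := by fun_prop
      exact (measurable_fst.add (h3.comp h2)).prodMk h2
    have hFeq (q : ℝ × E) (s : S) : F q s =
        Complex.exp (Complex.I * (θ * (q.1 + ⟪B z, q.2⟫) : ℝ)) *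
          (Complex.exp (Complex.I * (θ * innov T w A c z s q.2 : ℝ)) *
          (1 + θ ^ 2 * g (affineStep A c s q.2) : ℝ)) := by
      simp only [F, Ψ, testFun, ← mul_assoc, ← Complex.exp_add]
      congr 2
      simp only [innov, ← hz, inner_sub_left, B]
      push_cast; ring
    have hΨeq (q : ℝ × E) : Ψ θ q = Complex.exp (Complex.I * (θ * (q.1 + ⟪B z, q.2⟫) : ℝ)) *
          (1 + θ ^ 2 * g q.2 : ℝ) := by
      simp only [Ψ, testFun, ← mul_assoc, ← Complex.exp_add]
      congr 2
      push_cast; ring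
    have hY := (hUm n).prodMk (hXm n n le_rfl)
    have hind := indepFun_of_measurable_inputSigma hx.meas hx.indep (k := (n : ℤ) + 1) (by simp) hY
    have hFint (s : S) (hs : s ∈ T) : Integrable (fun ω => F (U n ω, X n ω) s) P := by
      have h4 := h.integrable_norm_step (hXmeas n) (hM n).1 hs
      refine Integrable.mono' ((integrable_const (1 : ℝ)).add
        (((integrable_const (1 : ℝ)).add h4).const_mul (8 * (‖B z‖ + C) * θ)))
        ((hFm s).comp ((hUmeas n).prodMk (hXmeas n))).aestronglyMeasurable
        (ae_of_all _ fun ω => ?_)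
      have := hdom hθ0 hθ1 (U n ω + ⟪u, affineStep A c s (X n ω)⟫, affineStep A c s (X n ω))
      have h6 := norm_le_norm_add_norm_sub' (F (U n ω, X n ω) s)
        (Complex.exp (Complex.I * (θ * (U n ω + ⟪u, affineStep A c s (X n ω)⟫) : ℝ)))
      rw [hnorm1] at h6
      exact h6.trans (add_le_add le_rfl this)
    have hint := (hx.integral_eq hind hFm hFint).2
    have hsucc : ∫ ω, Ψ θ (U (n + 1) ω, X (n + 1) ω) ∂P =
        ∫ ω, F (U n ω, X n ω) (x (n + 1) ω) ∂P := by
      refine integral_congr_ae (ae_of_all _ fun ω => ?_)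
      simp only [F, hU, Finset.sum_range_succ]
      rfl
    rw [hsucc, hint, ← integral_const_mul, ← integral_sub
      (integrable_finsetSum _ fun s hs => (hFint s hs).const_mul _) ((hΨint hθ0 hθ1 n).const_mul _)]
    refine (norm_integral_le_of_norm_le ((hVint n).const_mul (K * θ ^ 3))
      (ae_of_all _ fun ω => ?_)).trans ?_
    · have e1 : ∑ s ∈ T, ((w s : ℝ) : ℂ) * F (U n ω, X n ω) s -
          ((1 - θ ^ 2 * σ : ℝ) : ℂ) * Ψ θ (U n ω, X n ω) =
          Complex.exp (Complex.I * (θ * (U n ω + ⟪B z, X n ω⟫) : ℝ)) *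
          (∑ s ∈ T, (w s : ℂ) * (Complex.exp (Complex.I * (θ * innov T w A c z s (X n ω) : ℝ)) *
          (1 + θ ^ 2 * g (affineStep A c s (X n ω)) : ℝ)) -
        (((1 - θ ^ 2 * σ) * (1 + θ ^ 2 * g (X n ω)) : ℝ) : ℂ)) := by
        rw [hΨeq, mul_sub, Finset.mul_sum]
        congr 1
        · exact Finset.sum_congr rfl fun s _ => by rw [hFeq]; ring
        · push_cast; ring
      have := hK θ hθ0 hθ1 (X n ω)
      refine le_trans (le_of_eq ?_) this
      refine (congrArg norm e1).trans ?_
      rw [norm_mul, hnorm1, one_mul]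
    · rw [integral_const_mul]
      gcongr
      exact hVle n
  have hfin {θ : ℝ} (hθ0 : 0 ≤ θ) (hθ1 : θ ≤ 1) (n : ℕ) :
      ‖∫ ω, Ψ θ (U n ω, X n ω) ∂P - ∫ ω, Complex.exp (Complex.I * (θ * U n ω : ℝ)) ∂P‖ ≤
        8 * (‖B z‖ + C) * θ * (1 + M) := by
    rw [← integral_sub (hΨint hθ0 hθ1 n) (hexpint θ n)]
    refine (norm_integral_le_of_norm_le ((hVint n).const_mul (8 * (‖B z‖ + C) * θ))
      (ae_of_all _ fun ω => hdom hθ0 hθ1 _)).trans ?_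
    rw [integral_const_mul]
    gcongr
    exact hVle n
  set D := 8 * (‖B z‖ + C) * (1 + M) with hD
  have hD0 : 0 ≤ D := by positivity
  have hbound (n : ℕ) (hn : 1 ≤ n) :
      ‖∫ ω, Complex.exp (Complex.I * ((√n)⁻¹ * U n ω : ℝ)) ∂P - (1 + (-σ : ℂ) / n) ^ n‖ ≤
        (D + Real.exp |σ| * (K * (1 + M)) + Real.exp |σ| * D) * (√n)⁻¹ := by
    set θ : ℝ := (√n)⁻¹ with hθ
    have hn0 : (0 : ℝ) < n := by exact_mod_cast hn
    have hθ0 : 0 ≤ θ := by positivity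
    have hθ1 : θ ≤ 1 := inv_le_one_of_one_le₀ (Real.one_le_sqrt.2 (by exact_mod_cast hn))
    have hθ2 : θ ^ 2 = 1 / n := by rw [hθ, inv_pow, Real.sq_sqrt hn0.le, one_div]
    have hlam : ((1 - θ ^ 2 * σ : ℝ) : ℂ) = 1 + (-σ : ℂ) / n := by
      rw [hθ2]; push_cast; ring
    set lam : ℂ := 1 + (-σ : ℂ) / n with hlamdef
    have hlamn : ‖lam‖ ≤ Real.exp (|σ| / n) := by
      refine (norm_add_le _ _).trans ?_
      rw [norm_div, norm_neg, Complex.norm_real, Real.norm_eq_abs, norm_one, Complex.norm_natCast]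
      linarith [Real.add_one_le_exp (|σ| / n)]
    have hμ : 1 ≤ Real.exp (|σ| / n) := Real.one_le_exp (by positivity)
    have hμn : Real.exp (|σ| / n) ^ n = Real.exp |σ| := by
      rw [← Real.exp_nat_mul]; congr 1; field_simp
    have h1 := norm_sub_pow_mul_le (a := fun k => ∫ ω, Ψ θ (U k ω, X k ω) ∂P) (lam := lam) hμ
      (by positivity : 0 ≤ K * θ ^ 3 * (1 + M)) hlamn
      (fun k => by rw [← hlam]; exact hrec hθ0 hθ1 k) n
    have h2 := hfin hθ0 hθ1 n
    have h3 := hfin hθ0 hθ1 0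
    have h0 : ∫ ω, Complex.exp (Complex.I * (θ * U 0 ω : ℝ)) ∂P = 1 := by simp [hU]
    rw [h0] at h3
    rw [hμn] at h1
    have hpow : ‖lam ^ n‖ ≤ Real.exp |σ| := by
      rw [norm_pow, ← hμn]; gcongr
    have e1 : (n : ℝ) * Real.exp |σ| * (K * θ ^ 3 * (1 + M)) =
        Real.exp |σ| * (K * (1 + M)) * θ := by
      have : θ ^ 3 = θ ^ 2 * θ := by ring
      rw [this, hθ2]; field_simp
    rw [e1] at h1
    set a0 := ∫ ω, Ψ θ (U 0 ω, X 0 ω) ∂P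
    set an := ∫ ω, Ψ θ (U n ω, X n ω) ∂P
    set I := ∫ ω, Complex.exp (Complex.I * (θ * U n ω : ℝ)) ∂P
    -- Three errors of order `θ`: removing boundary term and corrector at time `n`, the accumulated
    -- recursion error, and the same removal at time `0`.
    have e2 : I - lam ^ n = -(an - I) + (an - lam ^ n * a0) + lam ^ n * (a0 - 1) := by ring
    rw [e2]
    calc _ ≤ 8 * (‖B z‖ + C) * θ * (1 + M) + Real.exp |σ| * (K * (1 + M)) * θ +
          Real.exp |σ| * (8 * (‖B z‖ + C) * θ * (1 + M)) := by
          refine norm_add₃_le.trans (add_le_add (add_le_add ?_ h1) ?_)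
          · rw [norm_neg]; exact h2
          · rw [norm_mul]; gcongr
      _ = _ := by rw [hD]; ring
  have hlim : Tendsto (fun n : ℕ => (1 + (-σ : ℂ) / n) ^ n) atTop (𝓝 (Complex.exp (-σ))) :=
    Complex.tendsto_one_add_div_pow_exp _
  refine tendsto_of_tendsto_of_dist hlim ?_
  have hz0 : Tendsto (fun n : ℕ => (D + Real.exp |σ| * (K * (1 + M)) + Real.exp |σ| * D) *
      (√n)⁻¹) atTop (𝓝 0) := by
    have : Tendsto (fun n : ℕ => (√(n : ℝ))⁻¹) atTop (𝓝 0) :=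
      (Real.tendsto_sqrt_atTop.comp tendsto_natCast_atTop_atTop).inv_tendsto_atTop
    simpa using this.const_mul (D + Real.exp |σ| * (K * (1 + M)) + Real.exp |σ| * D)
  refine squeeze_zero' (Eventually.of_forall fun n => dist_nonneg) ?_ hz0
  filter_upwards [eventually_ge_atTop 1] with n hn
  rw [dist_comm, dist_eq_norm]
  exact hbound n hn

end CLT

end

end RandomAffine

/-! ### Autocovariances and the long-run variance. -/

namespace RandomAffine

noncomputable section

set_option linter.unusedSectionVars false

open scoped RealInnerProductSpace

variable {Ω S E : Type*} [mΩ : MeasurableSpace Ω] [mS : MeasurableSpace S]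
  [MeasurableSingletonClass S]
  [NormedAddCommGroup E] [InnerProductSpace ℝ E] [FiniteDimensional ℝ E] [MeasurableSpace E]
  [BorelSpace E]

variable {T : Finset S} {w : S → ℝ} {A : S → E →L[ℝ] E} {c : S → E} {r : ℝ}
  {P : Measure Ω} [IsProbabilityMeasure P] {x : ℤ → Ω → S} {Z : ℤ → Ω → E}

lemma hasSum_of_eq {ι : Type*} {f g : ι → ℝ} {a : ℝ} (hfg : ∀ i, f i = g i) (h : HasSum g a) :
    HasSum f a :=
  (funext hfg : f = g) ▸ h

namespace IsStationaryProcess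

lemma memLp_two (hZ : IsStationaryProcess P x A c Z) (k : ℤ) : MemLp (Z k) 2 P :=
  (hZ.memLp k).mono_exponent (by norm_num)

lemma memLp_inner (hZ : IsStationaryProcess P x A c Z) (k : ℤ) (a : E) :
    MemLp (fun ω => ⟪Z k ω, a⟫) 2 P :=
  (hZ.memLp_two k).inner_const a

lemma integrable_mul (hZ : IsStationaryProcess P x A c Z) (k l : ℤ) (a b : E) :
    Integrable (fun ω => ⟪Z k ω, a⟫ * ⟪Z l ω, b⟫) P :=
  (hZ.memLp_inner k a).integrable_mul (hZ.memLp_inner l b)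

lemma integral_comp_eq (hZ : IsStationaryProcess P x A c Z) {g : E → ℝ} (hg : Measurable g)
    (k l : ℤ) : ∫ ω, g (Z k ω) ∂P = ∫ ω, g (Z l ω) ∂P := by
  rw [← integral_map (hZ.meas k).aemeasurable hg.aestronglyMeasurable,
    ← integral_map (hZ.meas l).aemeasurable hg.aestronglyMeasurable, hZ.map_eq k l]

/-- The second-moment form of the stationary law. -/
def secondMoment (P : Measure Ω) (Z : ℤ → Ω → E) (a b : E) : ℝ := ∫ ω, ⟪Z 0 ω, a⟫ * ⟪Z 0 ω, b⟫ ∂P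

lemma secondMoment_comm (a b : E) : secondMoment P Z a b = secondMoment P Z b a := by
  simp only [secondMoment, mul_comm]

lemma secondMoment_sub_right (hZ : IsStationaryProcess P x A c Z) (a b b' : E) :
    secondMoment P Z a (b - b') = secondMoment P Z a b - secondMoment P Z a b' := by
  simp only [secondMoment, inner_sub_right, mul_sub]
  exact integral_sub (hZ.integrable_mul 0 0 a b) (hZ.integrable_mul 0 0 a b')

lemma integral_inner_mul (hZ : IsStationaryProcess P x A c Z) (k : ℤ) (a b : E) :
    ∫ ω, ⟪Z k ω, a⟫ * ⟪Z k ω, b⟫ ∂P = secondMoment P Z a b :=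
  hZ.integral_comp_eq (g := fun v => ⟪v, a⟫ * ⟪v, b⟫) (by fun_prop) k 0

lemma abs_secondMoment_le (hZ : IsStationaryProcess P x A c Z) (a b : E) :
    |secondMoment P Z a b| ≤ (∫ ω, ‖Z 0 ω‖ ^ 2 ∂P) * ‖a‖ * ‖b‖ := by
  have hi : Integrable (fun ω => ‖Z 0 ω‖ ^ 2) P := (hZ.memLp_two 0).integrable_norm_pow (by simp)
  rw [mul_assoc, ← integral_mul_const]
  refine (abs_integral_le_integral_abs).trans (integral_mono (hZ.integrable_mul 0 0 a b).abs
    (hi.mul_const _) fun ω => ?_)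
  simp only [abs_mul]
  calc _ ≤ (‖Z 0 ω‖ * ‖a‖) * (‖Z 0 ω‖ * ‖b‖) := by
        gcongr <;> exact abs_real_inner_le_norm _ _
    _ = _ := by ring

lemma sum_inner_affineStep (h : AffineSystem T w A c r)
    (hsymm : ∀ s ∈ T, ∀ u v, ⟪A s u, v⟫ = ⟪u, A s v⟫) (hc : ∑ s ∈ T, w s • c s = 0) (e b : E) :
    ∑ s ∈ T, w s * ⟪affineStep A c s e, b⟫ = ⟪e, meanMap T w A b⟫ := by
  have := h.sum_innov hsymm hc b e
  simp only [AffineSystem.innov, mul_sub, Finset.sum_sub_distrib] at this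
  rw [← Finset.sum_mul, h.weight_sum, one_mul, sub_eq_zero] at this
  rw [real_inner_comm, ← this]
  simp_rw [real_inner_comm b]

/-- Averaging out the newest input, independent of the pair `(Z l, Z k)`, replaces `b` by its image
under the mean map. Iterating expresses every autocovariance through a second moment at one time. -/
lemma integral_mul_succ (hZ : IsStationaryProcess P x A c Z) (h : AffineSystem T w A c r)
    (hx : IIDInput P x T w) (hsymm : ∀ s ∈ T, ∀ u v, ⟪A s u, v⟫ = ⟪u, A s v⟫)
    (hc : ∑ s ∈ T, w s • c s = 0) {l k : ℤ} (hlk : l ≤ k) (a b : E) :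
    ∫ ω, ⟪Z l ω, a⟫ * ⟪Z (k + 1) ω, b⟫ ∂P = ∫ ω, ⟪Z l ω, a⟫ * ⟪Z k ω, meanMap T w A b⟫ ∂P := by
  have hA (s : S) : Continuous (affineStep A c s) := by unfold affineStep; fun_prop
  have hFint (s : S) (_ : s ∈ T) :
      Integrable (fun ω => ⟪Z l ω, a⟫ * ⟪affineStep A c s (Z k ω), b⟫) P := by
    have h1 : MemLp (fun ω => affineStep A c s (Z k ω)) 2 P :=
      ((A s).comp_memLp' (hZ.memLp_two k)).add (memLp_const (c s))
    exact (hZ.memLp_inner l a).integrable_mul (h1.inner_const b)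
  have h1 := (hx.integral_eq (hZ.indep l k hlk)
    (F := fun q s => ⟪q.1, a⟫ * ⟪affineStep A c s q.2, b⟫) (fun s => by
      have := hA s
      fun_prop) hFint).2
  have h2 : ∫ ω, ⟪Z l ω, a⟫ * ⟪Z (k + 1) ω, b⟫ ∂P =
      ∫ ω, ⟪Z l ω, a⟫ * ⟪affineStep A c (x (k + 1) ω) (Z k ω), b⟫ ∂P := by
    refine integral_congr_ae ?_
    filter_upwards [hZ.step (k + 1)] with ω hω
    rw [hω, add_sub_cancel_right]
  rw [h2, h1]
  refine integral_congr_ae (ae_of_all _ fun ω => ?_)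
  simp only [RCLike.ofReal_real_eq_id, id]
  rw [← sum_inner_affineStep h hsymm hc, Finset.mul_sum]
  exact Finset.sum_congr rfl fun s _ => by ring

lemma integral_mul_add (hZ : IsStationaryProcess P x A c Z) (h : AffineSystem T w A c r)
    (hx : IIDInput P x T w) (hsymm : ∀ s ∈ T, ∀ u v, ⟪A s u, v⟫ = ⟪u, A s v⟫)
    (hc : ∑ s ∈ T, w s • c s = 0) (l : ℤ) (n : ℕ) (a b : E) :
    ∫ ω, ⟪Z l ω, a⟫ * ⟪Z (l + n) ω, b⟫ ∂P = secondMoment P Z a ((meanMap T w A)^[n] b) := by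
  induction n generalizing b with
  | zero => simpa using hZ.integral_inner_mul l a b
  | succ n ih =>
    rw [Function.iterate_succ_apply, ← ih, Nat.cast_succ, ← add_assoc,
      hZ.integral_mul_succ h hx hsymm hc (by lia)]

/-- Write $a=z-Bz$: stationarity and averaging over one input give $\mathbb E\langle
Z,z\rangle=\mathbb E\langle Z,Bz\rangle$. -/
lemma integral_inner_eq_zero (hZ : IsStationaryProcess P x A c Z) (h : AffineSystem T w A c r)
    (hx : IIDInput P x T w) (hsymm : ∀ s ∈ T, ∀ u v, ⟪A s u, v⟫ = ⟪u, A s v⟫)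
    (hc : ∑ s ∈ T, w s • c s = 0) (k : ℤ) (a : E) : ∫ ω, ⟪Z k ω, a⟫ ∂P = 0 := by
  obtain ⟨z, hz⟩ := h.exists_sub_meanMap_eq a
  have hi (k : ℤ) (b : E) : Integrable (fun ω => ⟪Z k ω, b⟫) P :=
    (hZ.memLp_inner k b).integrable (by norm_num)
  have hA (s : S) : Continuous (affineStep A c s) := by unfold affineStep; fun_prop
  have h1 := (hx.integral_eq (hZ.indep k k le_rfl)
    (F := fun q s => ⟪affineStep A c s q.2, z⟫) (fun s => by
      have := hA s
      fun_prop) (fun s _ => by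
        have h1 : MemLp (fun ω => affineStep A c s (Z k ω)) 2 P :=
          ((A s).comp_memLp' (hZ.memLp_two k)).add (memLp_const (c s))
        exact (h1.inner_const z).integrable (by norm_num))).2
  have h2 : ∫ ω, ⟪Z (k + 1) ω, z⟫ ∂P = ∫ ω, ⟪affineStep A c (x (k + 1) ω) (Z k ω), z⟫ ∂P := by
    refine integral_congr_ae ?_
    filter_upwards [hZ.step (k + 1)] with ω hω
    rw [hω, add_sub_cancel_right]
  simp only [RCLike.ofReal_real_eq_id, id, sum_inner_affineStep h hsymm hc] at h1
  have h3 := hZ.integral_comp_eq (g := fun v => ⟪v, z⟫) (by fun_prop) (k + 1) k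
  rw [← hz]
  simp only [inner_sub_right]
  rw [integral_sub (hi k z) (hi k _), ← h3, h2, h1, sub_self]

/-- The series telescopes, since $B^nb=B^nz-B^{n+1}z$, and geometric decay of $B^nz$ removes the
boundary term. -/
lemma hasSum_secondMoment_iterate (hZ : IsStationaryProcess P x A c Z)
    (h : AffineSystem T w A c r) (a : E) {b z : E} (hz : z - meanMap T w A z = b) :
    HasSum (fun n : ℕ => secondMoment P Z a ((meanMap T w A)^[n] b)) (secondMoment P Z a z) := by
  set B := meanMap T w A
  set v : ℕ → ℝ := fun n => secondMoment P Z a (B^[n] z) with hv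
  have hpow (n : ℕ) : ‖B^[n] z‖ ≤ √r ^ n * ‖z‖ := by
    induction n with
    | zero => simp
    | succ n ih =>
      rw [Function.iterate_succ_apply', pow_succ', mul_assoc (√r)]
      exact (h.norm_meanMap_le _).trans (mul_le_mul_of_nonneg_left ih (Real.sqrt_nonneg r))
  have hsum : Summable v := by
    have h0 : 0 ≤ ∫ ω, ‖Z 0 ω‖ ^ 2 ∂P := integral_nonneg fun ω => by positivity
    have hb (n : ℕ) : ‖v n‖ ≤ (∫ ω, ‖Z 0 ω‖ ^ 2 ∂P) * ‖a‖ * ‖z‖ * √r ^ n := by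
      refine (hZ.abs_secondMoment_le a (B^[n] z)).trans ?_
      calc _ ≤ (∫ ω, ‖Z 0 ω‖ ^ 2 ∂P) * ‖a‖ * (√r ^ n * ‖z‖) :=
            mul_le_mul_of_nonneg_left (hpow n) (by positivity)
        _ = _ := by ring
    generalize (∫ ω, ‖Z 0 ω‖ ^ 2 ∂P) * ‖a‖ * ‖z‖ = M at hb
    exact Summable.of_norm_bounded
      ((summable_geometric_of_lt_one (Real.sqrt_nonneg r) h.sqrt_lt_one).mul_left M) hb
  have h1 := hsum.hasSum.sub ((summable_nat_add_iff 1).2 hsum).hasSum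
  rw [hsum.tsum_eq_zero_add, add_sub_cancel_right] at h1
  refine hasSum_of_eq (fun n => ?_) h1
  rw [hv]
  simp only [Function.iterate_succ_apply]
  rw [← hZ.secondMoment_sub_right, ← hz]
  congr 1
  have (n : ℕ) (p q : E) : B^[n] (p - q) = B^[n] p - B^[n] q := by
    induction n generalizing p q with
    | zero => rfl
    | succ n ih => simp only [Function.iterate_succ_apply, map_sub, ih]
  exact this n z (B z)

/-- The series of autocovariances. -/
theorem hasSum_integral_mul (hZ : IsStationaryProcess P x A c Z) (h : AffineSystem T w A c r)
    (hx : IIDInput P x T w) (hsymm : ∀ s ∈ T, ∀ u v, ⟪A s u, v⟫ = ⟪u, A s v⟫)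
    (hc : ∑ s ∈ T, w s • c s = 0) {a b za zb : E}
    (hza : za - meanMap T w A za = a) (hzb : zb - meanMap T w A zb = b) :
    HasSum (fun k : ℤ => ∫ ω, ⟪Z 0 ω, a⟫ * ⟪Z k ω, b⟫ ∂P)
      (secondMoment P Z a zb + (secondMoment P Z b za - secondMoment P Z b a)) := by
  -- Negative lags are read forward from time $-(n+1)$ to time $0$ with the vectors exchanged; lag
  -- zero, already counted, is subtracted once.
  refine HasSum.of_nat_of_neg_add_one ?_ ?_
  · refine hasSum_of_eq (fun n => ?_) (hZ.hasSum_secondMoment_iterate h a hzb)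
    simpa using hZ.integral_mul_add h hx hsymm hc 0 n a b
  · have h1 := hZ.hasSum_secondMoment_iterate h b hza
    have h2 := (hasSum_nat_add_iff' (f := fun n : ℕ =>
      secondMoment P Z b ((meanMap T w A)^[n] a)) 1).2 h1
    simp only [Finset.range_one, Finset.sum_singleton, Function.iterate_zero, id] at h2
    refine hasSum_of_eq (fun n => ?_) h2
    have := hZ.integral_mul_add h hx hsymm hc (-((n : ℤ) + 1)) (n + 1) b a
    rw [← this]
    refine integral_congr_ae (ae_of_all _ fun ω => ?_)
    simp [mul_comm]

/-- Twice the constant of the Poisson equation is the long-run variance. -/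
theorem two_mul_corrector_const (hZ : IsStationaryProcess P x A c Z)
    (h : AffineSystem T w A c r) (hx : IIDInput P x T w)
    (hsymm : ∀ s ∈ T, ∀ u v, ⟪A s u, v⟫ = ⟪u, A s v⟫) (hc : ∑ s ∈ T, w s • c s = 0) {u z : E}
    (hz : z - meanMap T w A z = u)
    {g : E → ℝ} {σ C : ℝ} (hgcont : Continuous g)
    (hgC : ∀ e, |g e| ≤ C * (1 + ‖e‖) ^ 2)
    (hg : ∀ e, ∑ s ∈ T, w s * g (affineStep A c s e) - g e =
        (∑ s ∈ T, w s * AffineSystem.innov T w A c z s e ^ 2) / 2 - σ) :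
    0 ≤ σ ∧ 2 * σ =
      secondMoment P Z u z + (secondMoment P Z u z - secondMoment P Z u u) := by
  have hA (s : S) : Continuous (affineStep A c s) := by unfold affineStep; fun_prop
  have hAZ (s : S) : MemLp (fun ω => affineStep A c s (Z 0 ω)) 2 P :=
    ((A s).comp_memLp' (hZ.memLp_two 0)).add (memLp_const (c s))
  have havg {g : E → ℝ} (hgc : Continuous g)
      (hi : ∀ s ∈ T, Integrable (fun ω => g (affineStep A c s (Z 0 ω))) P) :
      ∫ ω, ∑ s ∈ T, w s * g (affineStep A c s (Z 0 ω)) ∂P = ∫ ω, g (Z 0 ω) ∂P := by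
    have h1 := (hx.integral_eq (hZ.indep 0 0 le_rfl)
      (F := fun q s => g (affineStep A c s q.2)) (fun s => by
        have := hA s
        exact (hgc.comp (this.comp continuous_snd)).measurable) hi).2
    rw [hZ.integral_comp_eq hgc.measurable 0 (0 + 1)]
    refine h1.symm.trans (integral_congr_ae ?_)
    filter_upwards [hZ.step (0 + 1)] with ω hω
    rw [hω, add_sub_cancel_right]
  have hgint {Y : Ω → E} (hY : MemLp Y 2 P) : Integrable (fun ω => g (Y ω)) P := by
    have h1 : Integrable (fun ω => (1 + ‖Y ω‖) ^ 2) P :=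
      ((memLp_const (1 : ℝ)).add hY.norm).integrable_sq
    refine Integrable.mono' (h1.const_mul C) (hgcont.comp_aestronglyMeasurable hY.1)
      (ae_of_all _ fun ω => hgC _)
  have hsq (a : E) : Integrable (fun ω => ⟪Z 0 ω, a⟫ * ⟪Z 0 ω, a⟫) P := hZ.integrable_mul 0 0 a a
  have h1 := havg hgcont fun s _ => hgint (hAZ s)
  have h2 := havg (g := fun e => ⟪e, z⟫ * ⟪e, z⟫) (by fun_prop) fun s _ =>
    ((hAZ s).inner_const z).integrable_mul ((hAZ s).inner_const z)
  set B := meanMap T w A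
  -- Conditional variance as conditional second moment minus squared conditional mean.
  have hq (e : E) : ∑ s ∈ T, w s * AffineSystem.innov T w A c z s e ^ 2 =
      ∑ s ∈ T, w s * (⟪affineStep A c s e, z⟫ * ⟪affineStep A c s e, z⟫) -
        ⟪e, B z⟫ * ⟪e, B z⟫ := by
    have h3 := sum_inner_affineStep h hsymm hc e z
    have h4 : ∑ s ∈ T, w s * AffineSystem.innov T w A c z s e ^ 2 =
        ∑ s ∈ T, w s * (⟪affineStep A c s e, z⟫ * ⟪affineStep A c s e, z⟫) -
        2 * ⟪e, B z⟫ * (∑ s ∈ T, w s * ⟪affineStep A c s e, z⟫) +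
        (∑ s ∈ T, w s) * (⟪e, B z⟫ * ⟪e, B z⟫) := by
      rw [Finset.mul_sum, Finset.sum_mul, ← Finset.sum_sub_distrib, ← Finset.sum_add_distrib]
      refine Finset.sum_congr rfl fun s _ => ?_
      rw [AffineSystem.innov, real_inner_comm z, real_inner_comm (meanMap T w A z)]
      ring
    rw [h4, h3, h.weight_sum]; ring
  have hqnonneg (e : E) : 0 ≤ ∑ s ∈ T, w s * AffineSystem.innov T w A c z s e ^ 2 :=
    Finset.sum_nonneg fun s hs => mul_nonneg (h.weight_nonneg s hs) (sq_nonneg _)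
  have hsumint : Integrable (fun ω => ∑ s ∈ T,
      w s * (⟪affineStep A c s (Z 0 ω), z⟫ * ⟪affineStep A c s (Z 0 ω), z⟫)) P :=
    integrable_finsetSum _ fun s _ =>
      (((hAZ s).inner_const z).integrable_mul ((hAZ s).inner_const z)).const_mul _
  have hqint : Integrable (fun ω => ∑ s ∈ T,
      w s * AffineSystem.innov T w A c z s (Z 0 ω) ^ 2) P := by
    simp_rw [hq]
    exact hsumint.sub (hsq _)
  have hσ : ∫ ω, ∑ s ∈ T, w s * AffineSystem.innov T w A c z s (Z 0 ω) ^ 2 ∂P = 2 * σ := by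
    -- By stationarity the left side of the Poisson equation integrates to zero.
    have h5 : ∫ ω, (∑ s ∈ T, w s * g (affineStep A c s (Z 0 ω)) - g (Z 0 ω)) ∂P = 0 := by
      rw [integral_sub (integrable_finsetSum _ fun s _ => (hgint (hAZ s)).const_mul _)
        (hgint (hZ.memLp_two 0)), h1, sub_self]
    simp_rw [hg] at h5
    rw [integral_sub (hqint.div_const 2) (integrable_const _), integral_div] at h5
    simp at h5
    linarith
  refine ⟨?_, ?_⟩
  · have : 0 ≤ ∫ ω, ∑ s ∈ T, w s * AffineSystem.innov T w A c z s (Z 0 ω) ^ 2 ∂P :=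
      integral_nonneg fun ω => hqnonneg (Z 0 ω)
    rw [hσ] at this
    linarith
  -- With `M` the second-moment form, the variance is $M(z,z)-M(Bz,Bz)$; substituting $Bz=z-u$ gives
  -- $2M(u,z)-M(u,u)$.
  · rw [← hσ]
    simp_rw [hq]
    rw [integral_sub hsumint (hsq _), h2, ← integral_sub (hsq z) (hsq _)]
    simp only [secondMoment]
    have hi := hZ.integrable_mul 0 0 u z
    rw [← integral_sub hi (hsq u)]
    refine Eq.trans ?_ (integral_add hi (hi.sub (hsq u)))
    refine integral_congr_ae (ae_of_all _ fun ω => ?_)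
    simp only [← hz, inner_sub_right]
    ring

end IsStationaryProcess

end

end RandomAffine

/-! ### Moments of the dropout law and contraction of the gradient step. -/

namespace GDDropout

noncomputable section

set_option linter.unusedSectionVars false

open scoped RealInnerProductSpace
open Matrix RandomAffine

variable {m n d : ℕ}

/-! ### The dropout law -/

/-- The finite support `{0,1}^d` of the dropout law. -/
def dropoutSupport (d : ℕ) : Finset (Fin d → ℝ) := Fintype.piFinset fun _ => {0, 1}

/-- The point masses of the dropout law. -/
def dropoutWeight (d : ℕ) (p : unitInterval) (s : Fin d → ℝ) : ℝ := (dropoutLaw d p).real {s}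

instance (p : unitInterval) : IsProbabilityMeasure (dropoutLaw d p) := by
  unfold dropoutLaw; infer_instance

lemma mem_dropoutSupport {s : Fin d → ℝ} : s ∈ dropoutSupport d ↔ ∀ i, s i = 0 ∨ s i = 1 := by
  simp [dropoutSupport, Fintype.mem_piFinset]

lemma ae_mem_dropoutSupport (p : unitInterval) :
    ∀ᵐ s ∂(dropoutLaw d p), s ∈ dropoutSupport d := by
  simp_rw [mem_dropoutSupport]
  rw [ae_all_iff]
  intro i
  have h1 : ∀ᵐ t ∂(bernoulliMeasure (1 : ℝ) 0 p), t = 0 ∨ t = 1 := by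
    rw [bernoulliMeasure_def, ae_add_measure_iff]
    constructor
    · refine Measure.ae_smul_measure ?_ _
      rw [ae_dirac_eq]; simp
    · refine Measure.ae_smul_measure ?_ _
      rw [ae_dirac_eq]; simp
  exact (measurePreserving_eval (fun _ : Fin d => bernoulliMeasure (1 : ℝ) 0 p)
    i).quasiMeasurePreserving.ae h1

lemma restrict_dropoutSupport (p : unitInterval) :
    (dropoutLaw d p).restrict (dropoutSupport d) = dropoutLaw d p :=
  Measure.restrict_eq_self_of_ae_mem (ae_mem_dropoutSupport p)

lemma integrable_dropoutLaw {F : Type*} [NormedAddCommGroup F] (p : unitInterval)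
    (g : (Fin d → ℝ) → F) : Integrable g (dropoutLaw d p) := by
  have : IntegrableOn g (dropoutSupport d) (dropoutLaw d p) :=
    IntegrableOn.finset
  rwa [IntegrableOn, restrict_dropoutSupport] at this

lemma integral_dropoutLaw (p : unitInterval) (g : (Fin d → ℝ) → ℝ) :
    ∫ s, g s ∂(dropoutLaw d p) = ∑ s ∈ dropoutSupport d, dropoutWeight d p s * g s := by
  conv_lhs => rw [← restrict_dropoutSupport]
  rw [setIntegral_finset _ (integrable_dropoutLaw p g).integrableOn]
  rfl

lemma dropoutWeight_nonneg (p : unitInterval) (s : Fin d → ℝ) : 0 ≤ dropoutWeight d p s :=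
  measureReal_nonneg

lemma sum_dropoutWeight (p : unitInterval) : ∑ s ∈ dropoutSupport d, dropoutWeight d p s = 1 := by
  have := integral_dropoutLaw (d := d) p fun _ => 1
  simpa using this.symm

lemma sum_dropoutWeight_mul (p : unitInterval) (i : Fin d) :
    ∑ s ∈ dropoutSupport d, dropoutWeight d p s * s i = p := by
  rw [← integral_dropoutLaw p fun s => s i, dropoutLaw]
  have := integral_comp_eval (μ := fun _ : Fin d => bernoulliMeasure (1 : ℝ) 0 p) (i := i)
    (f := fun t : ℝ => t) (by fun_prop)
  rw [this, integral_bernoulliMeasure]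
  simp

/-- Off the diagonal this is independence; on it, entries in $\{0,1\}$ equal their squares. The
difference is the source of the rescaling in $\mathbb X_p$. -/
lemma sum_dropoutWeight_mul_mul (p : unitInterval) (i j : Fin d) :
    ∑ s ∈ dropoutSupport d, dropoutWeight d p s * (s i * s j) =
      p ^ 2 + if i = j then (p : ℝ) * (1 - p) else 0 := by
  by_cases hij : i = j
  · subst hij
    have : ∑ s ∈ dropoutSupport d, dropoutWeight d p s * (s i * s i) =
        ∑ s ∈ dropoutSupport d, dropoutWeight d p s * s i := by
      refine Finset.sum_congr rfl fun s hs => ?_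
      rcases mem_dropoutSupport.1 hs i with h | h <;> simp [h]
    rw [this, sum_dropoutWeight_mul]
    simp; ring
  · rw [← integral_dropoutLaw p fun s => s i * s j]
    have h1 := (iIndepFun_pi (μ := fun _ : Fin d => bernoulliMeasure (1 : ℝ) 0 p)
      (X := fun _ t => t) fun _ => aemeasurable_id).indepFun hij
    have h2 := h1.integral_fun_mul_eq_mul_integral (integrable_dropoutLaw p fun s => s i).1
      (integrable_dropoutLaw p fun s => s j).1
    have h3 := integral_dropoutLaw p fun s : Fin d → ℝ => s i
    have h4 := integral_dropoutLaw p fun s : Fin d → ℝ => s j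
    rw [sum_dropoutWeight_mul] at h3 h4
    change ∫ s, s i * s j ∂(dropoutLaw d p) = _ at h2
    rw [h2]
    change (∫ s, s i ∂(dropoutLaw d p)) * (∫ s, s j ∂(dropoutLaw d p)) = _
    rw [h3, h4]
    simp [hij]; ring

/-- The mean of `D A D`. -/
lemma sum_dropoutWeight_smul_diagonal (p : unitInterval) (G : Matrix (Fin d) (Fin d) ℝ) :
    ∑ s ∈ dropoutSupport d, dropoutWeight d p s • (diagonal s * G * diagonal s) =
      (p : ℝ) • rescaled p G := by
  ext i j
  have h := sum_dropoutWeight_mul_mul p i j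
  rw [Matrix.sum_apply]
  simp only [Matrix.smul_apply, mul_diagonal, diagonal_mul, smul_eq_mul, rescaled,
    Matrix.add_apply]
  have e : ∑ s ∈ dropoutSupport d, dropoutWeight d p s * (s i * G i j * s j) =
      (∑ s ∈ dropoutSupport d, dropoutWeight d p s * (s i * s j)) * G i j := by
    rw [Finset.sum_mul]
    exact Finset.sum_congr rfl fun s _ => by ring
  rw [e, h]
  by_cases hij : i = j
  · subst hij; simp; ring
  · simp [hij]; ring

lemma sum_dropoutWeight_smul (p : unitInterval) (B : Matrix (Fin d) (Fin m) ℝ) :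
    ∑ s ∈ dropoutSupport d, dropoutWeight d p s • (diagonal s * B) = (p : ℝ) • B := by
  ext i j
  rw [Matrix.sum_apply]
  simp only [Matrix.smul_apply, diagonal_mul, smul_eq_mul]
  rw [← sum_dropoutWeight_mul p i, Finset.sum_mul]
  exact Finset.sum_congr rfl fun s _ => by ring

/-! ### Matrices acting on Euclidean space -/

lemma toEuclideanLin_mul_apply (A : Matrix (Fin m) (Fin n) ℝ) (B : Matrix (Fin n) (Fin d) ℝ)
    (v : EuclideanSpace ℝ (Fin d)) :
    toEuclideanLin (A * B) v = toEuclideanLin A (toEuclideanLin B v) := by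
  simp [toLpLin_apply, mulVec_mulVec]

lemma inner_toEuclideanLin_left (A : Matrix (Fin m) (Fin n) ℝ) (u : EuclideanSpace ℝ (Fin n))
    (v : EuclideanSpace ℝ (Fin m)) :
    ⟪toEuclideanLin A u, v⟫ = ⟪u, toEuclideanLin Aᵀ v⟫ := by
  have h := toEuclideanLin_conjTranspose_eq_adjoint A
  rw [conjTranspose_eq_transpose_of_trivial] at h
  rw [h, LinearMap.adjoint_inner_right]

lemma norm_diagonal_le {s : Fin d → ℝ} (hs : s ∈ dropoutSupport d) (v : EuclideanSpace ℝ (Fin d)) :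
    ‖toEuclideanLin (diagonal s) v‖ ≤ ‖v‖ := by
  rw [EuclideanSpace.norm_eq, EuclideanSpace.norm_eq]
  refine Real.sqrt_le_sqrt (Finset.sum_le_sum fun i _ => ?_)
  rcases mem_dropoutSupport.1 hs i with h | h <;> 
    simp [toLpLin_apply, mulVec_diagonal, h, sq_nonneg]

/-- With $g=\mathbb Xu$, combine $\|g\|^2=\langle Xu,Xg\rangle\le\|Xu\|\|Xg\|$ with
$\|Xg\|^2=\langle\mathbb Xg,g\rangle\le\|\mathbb X\|\|g\|^2$. -/
lemma norm_gram_sq_le (X : Matrix (Fin m) (Fin d) ℝ) (u : EuclideanSpace ℝ (Fin d)) :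
    ‖toEuclideanLin (gram X) u‖ ^ 2 ≤
      ‖toEuclideanCLM (n := Fin d) (𝕜 := ℝ) (gram X)‖ * ‖toEuclideanLin X u‖ ^ 2 := by
  set N := ‖toEuclideanCLM (n := Fin d) (𝕜 := ℝ) (gram X)‖
  have hN : 0 ≤ N := norm_nonneg _
  have hin (a b : EuclideanSpace ℝ (Fin d)) :
      ⟪toEuclideanLin (gram X) a, b⟫ = ⟪toEuclideanLin X a, toEuclideanLin X b⟫ := by
    rw [gram, toEuclideanLin_mul_apply, inner_toEuclideanLin_left, transpose_transpose]
  have hle (a : EuclideanSpace ℝ (Fin d)) : ‖toEuclideanLin (gram X) a‖ ≤ N * ‖a‖ :=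
    (toEuclideanCLM (n := Fin d) (𝕜 := ℝ) (gram X)).le_opNorm a
  set g := toEuclideanLin (gram X) u
  have h1 : ‖g‖ ^ 2 ≤ ‖toEuclideanLin X u‖ * ‖toEuclideanLin X g‖ := by
    rw [← real_inner_self_eq_norm_sq]
    exact (hin u g).trans_le (real_inner_le_norm _ _)
  have h2 : ‖toEuclideanLin X g‖ ^ 2 ≤ N * ‖g‖ ^ 2 := by
    rw [← real_inner_self_eq_norm_sq, ← hin]
    calc _ ≤ ‖toEuclideanLin (gram X) g‖ * ‖g‖ := real_inner_le_norm _ _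
      _ ≤ N * ‖g‖ * ‖g‖ := by gcongr; exact hle g
      _ = _ := by ring
  by_cases hg : ‖g‖ = 0
  · rw [hg]; simpa using mul_nonneg hN (sq_nonneg _)
  · have hg2 : 0 < ‖g‖ ^ 2 := by positivity
    have h3 : ‖g‖ ^ 2 * ‖g‖ ^ 2 ≤ N * ‖toEuclideanLin X u‖ ^ 2 * ‖g‖ ^ 2 := by
      calc ‖g‖ ^ 2 * ‖g‖ ^ 2 ≤ (‖toEuclideanLin X u‖ * ‖toEuclideanLin X g‖) *
            (‖toEuclideanLin X u‖ * ‖toEuclideanLin X g‖) := by gcongr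
        _ = ‖toEuclideanLin X u‖ ^ 2 * ‖toEuclideanLin X g‖ ^ 2 := by ring
        _ ≤ ‖toEuclideanLin X u‖ ^ 2 * (N * ‖g‖ ^ 2) := by gcongr
        _ = _ := by ring
    exact le_of_mul_le_mul_right h3 hg2

/-! ### The gradient step as an affine map -/

/-- The linear part `I - α D 𝕏 D` of the gradient step. -/
def stepLin (X : Matrix (Fin m) (Fin d) ℝ) (α : ℝ) (s : Fin d → ℝ) :
    EuclideanSpace ℝ (Fin d) →L[ℝ] EuclideanSpace ℝ (Fin d) :=
  1 - α • toEuclideanCLM (n := Fin d) (𝕜 := ℝ) (diagonal s * gram X * diagonal s)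

lemma stepLin_apply (X : Matrix (Fin m) (Fin d) ℝ) (α : ℝ) (s : Fin d → ℝ)
    (v : EuclideanSpace ℝ (Fin d)) :
    stepLin X α s v = v - α • toEuclideanLin (diagonal s * gram X * diagonal s) v := rfl

/-- The base point is arbitrary: `0` gives the affine form of the recursion, the regularized
estimator its centred form. -/
lemma gdStep_add (X : Matrix (Fin m) (Fin d) ℝ) (y : EuclideanSpace ℝ (Fin m)) (α : ℝ)
    (s : Fin d → ℝ) (b e : EuclideanSpace ℝ (Fin d)) :
    gdStep X y α s (b + e) = stepLin X α s e + gdStep X y α s b := by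
  have h : toEuclideanLin (diagonal s * gram X * diagonal s) e =
      toEuclideanLin (diagonal s * Xᵀ) (toEuclideanLin (X * diagonal s) e) := by
    rw [← toEuclideanLin_mul_apply, gram]; simp only [Matrix.mul_assoc]
  simp only [gdStep, stepLin_apply, h, map_add, map_sub, smul_sub, smul_add]
  abel

lemma gdStep_eq_affineStep (X : Matrix (Fin m) (Fin d) ℝ) (y : EuclideanSpace ℝ (Fin m)) (α : ℝ) :
    gdStep X y α = affineStep (stepLin X α) fun s => gdStep X y α s 0 := by
  ext1 s; ext1 e
  rw [← zero_add e, gdStep_add, zero_add]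
  rfl

lemma continuous_gdStep (X : Matrix (Fin m) (Fin d) ℝ) (α : ℝ) :
    Continuous fun q : (Fin d → ℝ) × EuclideanSpace ℝ (Fin d) × EuclideanSpace ℝ (Fin m) =>
      gdStep X q.2.2 α q.1 q.2.1 := by
  simp only [gdStep, toLpLin_apply]
  fun_prop

lemma inner_stepLin (X : Matrix (Fin m) (Fin d) ℝ) (α : ℝ) (s : Fin d → ℝ)
    (u v : EuclideanSpace ℝ (Fin d)) : ⟪stepLin X α s u, v⟫ = ⟪u, stepLin X α s v⟫ := by
  have h : (diagonal s * gram X * diagonal s)ᵀ = diagonal s * gram X * diagonal s := by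
    simp [gram, Matrix.mul_assoc]
  rw [stepLin_apply, stepLin_apply, inner_sub_left, inner_sub_right, real_inner_smul_left,
    real_inner_smul_right, inner_toEuclideanLin_left, h]

/-- Expand the square. The cross term is exactly $-2\alpha\|XDv\|^2$, and $\|D\mathbb
XDv\|\le\|\mathbb XDv\|$ bounds the quadratic term. -/
lemma norm_stepLin_sq_le (X : Matrix (Fin m) (Fin d) ℝ) {α : ℝ} {s : Fin d → ℝ}
    (hs : s ∈ dropoutSupport d) (v : EuclideanSpace ℝ (Fin d)) :
    ‖stepLin X α s v‖ ^ 2 ≤ ‖v‖ ^ 2 -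
      α * (2 - α * ‖toEuclideanCLM (n := Fin d) (𝕜 := ℝ) (gram X)‖) *
        ‖toEuclideanLin (X * diagonal s) v‖ ^ 2 := by
  have e1 : toEuclideanLin (diagonal s * gram X * diagonal s) v =
      toEuclideanLin (diagonal s) (toEuclideanLin (gram X) (toEuclideanLin (diagonal s) v)) := by
    rw [toEuclideanLin_mul_apply, toEuclideanLin_mul_apply]
  have e2 : ⟪v, toEuclideanLin (diagonal s * gram X * diagonal s) v⟫ =
      ‖toEuclideanLin (X * diagonal s) v‖ ^ 2 := by
    rw [← real_inner_self_eq_norm_sq, inner_toEuclideanLin_left, ← toEuclideanLin_mul_apply]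
    congr 3
    simp [gram, Matrix.mul_assoc]
  have h3 : ‖toEuclideanLin (diagonal s * gram X * diagonal s) v‖ ^ 2 ≤
      ‖toEuclideanCLM (n := Fin d) (𝕜 := ℝ) (gram X)‖ *
        ‖toEuclideanLin (X * diagonal s) v‖ ^ 2 := by
    rw [e1, toEuclideanLin_mul_apply X]
    refine le_trans ?_ (norm_gram_sq_le X _)
    gcongr
    exact norm_diagonal_le hs _
  rw [stepLin_apply, norm_sub_sq_real, real_inner_smul_right, e2, norm_smul, mul_pow,
    Real.norm_eq_abs, sq_abs]
  nlinarith [mul_le_mul_of_nonneg_left h3 (sq_nonneg α)]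

lemma sum_norm_mul_diagonal_sq (X : Matrix (Fin m) (Fin d) ℝ) (p : unitInterval)
    (v : EuclideanSpace ℝ (Fin d)) :
    ∑ s ∈ dropoutSupport d, dropoutWeight d p s * ‖toEuclideanLin (X * diagonal s) v‖ ^ 2 =
      p * ⟪v, toEuclideanLin (rescaled p (gram X)) v⟫ := by
  have e2 (s : Fin d → ℝ) : ‖toEuclideanLin (X * diagonal s) v‖ ^ 2 =
      ⟪v, toEuclideanLin (diagonal s * gram X * diagonal s) v⟫ := by
    rw [← real_inner_self_eq_norm_sq, inner_toEuclideanLin_left, ← toEuclideanLin_mul_apply]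
    congr 3
    simp [gram, Matrix.mul_assoc]
  simp_rw [e2, ← real_inner_smul_right]
  rw [← inner_sum, ← LinearMap.smul_apply, ← map_smul, ← sum_dropoutWeight_smul_diagonal, map_sum]
  simp

/-- $\mathbb X_p$ dominates $(1-p)\mathrm{Diag}(\mathbb X)$, whose entries are the squared norms of
the nonzero columns. No rank condition on `X` is needed. -/
lemma rescaled_gram_lower_bound (X : Matrix (Fin m) (Fin d) ℝ) (hX : ∀ j, ∃ i, X i j ≠ 0)
    (p : unitInterval) (hp1 : p < 1) :
    ∃ κ : ℝ, 0 < κ ∧ ∀ v : EuclideanSpace ℝ (Fin d),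
      κ * ‖v‖ ^ 2 ≤ ⟪v, toEuclideanLin (rescaled p (gram X)) v⟫ := by
  have hp0 : (0 : ℝ) ≤ p := p.2.1
  have hp1' : (0 : ℝ) < 1 - p := by have : (p : ℝ) < 1 := hp1; linarith
  have hpos (j : Fin d) : 0 < gram X j j := by
    obtain ⟨i, hi⟩ := hX j
    simp only [gram, Matrix.mul_apply, transpose_apply]
    exact Finset.sum_pos' (fun i _ => mul_self_nonneg _) ⟨i, Finset.mem_univ _, mul_self_pos.2 hi⟩
  obtain ⟨κ, hκ0, hκ⟩ : ∃ κ : ℝ, 0 < κ ∧ ∀ j, κ ≤ gram X j j := by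
    rcases isEmpty_or_nonempty (Fin d) with hd | hd
    · exact ⟨1, one_pos, fun j => (hd.false j).elim⟩
    · obtain ⟨j, hj⟩ := Finite.exists_min fun j => gram X j j
      exact ⟨_, hpos j, hj⟩
  refine ⟨(1 - p) * κ, by positivity, fun v => ?_⟩
  have e1 : ⟪v, toEuclideanLin (rescaled p (gram X)) v⟫ =
      p * ‖toEuclideanLin X v‖ ^ 2 + (1 - p) * ∑ j, gram X j j * v j ^ 2 := by
    rw [rescaled, map_add, LinearMap.add_apply, inner_add_right, map_smul, map_smul,
      LinearMap.smul_apply, LinearMap.smul_apply, real_inner_smul_right, real_inner_smul_right]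
    congr 2
    · rw [← real_inner_self_eq_norm_sq, inner_toEuclideanLin_left, ← toEuclideanLin_mul_apply, gram]
    · simp only [PiLp.inner_apply, toLpLin_apply, mulVec_diagonal]
      refine Finset.sum_congr rfl fun j _ => ?_
      simp; ring
  rw [e1, EuclideanSpace.real_norm_sq_eq]
  have h2 : κ * ∑ j, v j ^ 2 ≤ ∑ j, gram X j j * v j ^ 2 := by
    rw [Finset.mul_sum]
    exact Finset.sum_le_sum fun j _ => by gcongr; exact hκ j
  calc _ = (1 - (p : ℝ)) * (κ * ∑ j, v j ^ 2) := by ring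
    _ ≤ (1 - (p : ℝ)) * ∑ j, gram X j j * v j ^ 2 := by gcongr
    _ ≤ _ := by have : 0 ≤ (p : ℝ) * ‖toEuclideanLin X v‖ ^ 2 := by positivity
                linarith

end

end GDDropout

/-! ### The regularized estimator and the reduction to affine systems. -/

namespace GDDropout

noncomputable section

set_option linter.unusedSectionVars false

open scoped RealInnerProductSpace
open Matrix RandomAffine

variable {m n d : ℕ}

/-! ### The regularized least-squares estimator -/

/-- Coercivity makes $\mathbb X_p$ injective, so the matrix inverse in the estimator is a genuine
one. -/
lemma toEuclideanLin_rescaled_regEstimator (X : Matrix (Fin m) (Fin d) ℝ)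
    (hX : ∀ j, ∃ i, X i j ≠ 0) (p : unitInterval) (hp1 : p < 1) (y : EuclideanSpace ℝ (Fin m)) :
    toEuclideanLin (rescaled p (gram X)) (regEstimator X p y) = toEuclideanLin Xᵀ y := by
  obtain ⟨κ, hκ0, hκ⟩ := rescaled_gram_lower_bound X hX p hp1
  have hinj : Function.Injective (rescaled p (gram X)).mulVec := by
    refine (injective_iff_map_eq_zero (mulVecLin (rescaled p (gram X)))).2 fun v hv => ?_
    have h1 := hκ (WithLp.toLp 2 v)
    have h2 : toEuclideanLin (rescaled p (gram X)) (WithLp.toLp 2 v) = 0 := by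
      simpa [toLpLin_apply] using hv
    rw [h2, inner_zero_right] at h1
    have h3 : ‖(WithLp.toLp 2 v : EuclideanSpace ℝ (Fin d))‖ ^ 2 ≤ 0 := by
      by_contra! h
      have := mul_pos hκ0 h
      linarith
    have h4 : (WithLp.toLp 2 v : EuclideanSpace ℝ (Fin d)) = 0 := by
      rw [← norm_eq_zero]
      exact pow_eq_zero_iff (two_ne_zero) |>.1 (le_antisymm h3 (sq_nonneg _))
    simpa using h4
  have hu : IsUnit (rescaled p (gram X)).det :=
    (isUnit_iff_isUnit_det _).1 (mulVec_injective_iff_isUnit.1 hinj)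
  rw [regEstimator, ← toEuclideanLin_mul_apply, mul_nonsing_inv_cancel_left _ _ hu]

/-- The averaged gradient vanishes at the regularized estimator. -/
lemma sum_gradient_eq_zero (X : Matrix (Fin m) (Fin d) ℝ)
    (hX : ∀ j, ∃ i, X i j ≠ 0) (p : unitInterval) (hp1 : p < 1) (y : EuclideanSpace ℝ (Fin m)) :
    ∑ s ∈ dropoutSupport d, dropoutWeight d p s • toEuclideanLin (diagonal s * Xᵀ)
      (y - toEuclideanLin (X * diagonal s) (regEstimator X p y)) = 0 := by
  have e (s : Fin d → ℝ) : toEuclideanLin (diagonal s * Xᵀ)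
      (y - toEuclideanLin (X * diagonal s) (regEstimator X p y)) =
      toEuclideanLin (diagonal s * Xᵀ) y -
        toEuclideanLin (diagonal s * gram X * diagonal s) (regEstimator X p y) := by
    rw [map_sub, ← toEuclideanLin_mul_apply, gram]
    simp only [Matrix.mul_assoc]
  have h1 : ∑ s ∈ dropoutSupport d, dropoutWeight d p s • toEuclideanLin (diagonal s * Xᵀ) y =
      (p : ℝ) • toEuclideanLin Xᵀ y := by
    rw [← LinearMap.smul_apply, ← map_smul, ← sum_dropoutWeight_smul, map_sum]
    simp
  have h2 : ∑ s ∈ dropoutSupport d, dropoutWeight d p s •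
      toEuclideanLin (diagonal s * gram X * diagonal s) (regEstimator X p y) =
      (p : ℝ) • toEuclideanLin Xᵀ y := by
    rw [← toEuclideanLin_rescaled_regEstimator X hX p hp1, ← LinearMap.smul_apply, ← map_smul,
      ← sum_dropoutWeight_smul_diagonal, map_sum]
    simp
  simp_rw [e, smul_sub, Finset.sum_sub_distrib]
  rw [h1, h2, sub_self]

/-- The regularized estimator is the unique minimizer of the averaged risk. -/
theorem dropoutRisk_regEstimator_lt (X : Matrix (Fin m) (Fin d) ℝ)
    (hX : ∀ j, ∃ i, X i j ≠ 0) (p : unitInterval) (hp0 : 0 < p) (hp1 : p < 1)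
    (y : EuclideanSpace ℝ (Fin m)) (b : EuclideanSpace ℝ (Fin d)) (hb : b ≠ regEstimator X p y) :
    dropoutRisk X p y (regEstimator X p y) < dropoutRisk X p y b := by
  obtain ⟨κ, hκ0, hκ⟩ := rescaled_gram_lower_bound X hX p hp1
  have hp : (0 : ℝ) < p := hp0
  set β := regEstimator X p y with hβ
  set e := b - β with he
  have he0 : 0 < ‖e‖ := norm_pos_iff.2 (sub_ne_zero.2 hb)
  have hbe : b = β + e := by rw [he]; abel
  -- Exact second-order expansion at the estimator: the linear term averages to zero and the
  -- quadratic one to $\tfrac p2e^\top\mathbb X_pe>0$.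
  have key (s : Fin d → ℝ) : 1 / 2 * ‖y - toEuclideanLin (X * diagonal s) b‖ ^ 2 =
      1 / 2 * ‖y - toEuclideanLin (X * diagonal s) β‖ ^ 2 -
      ⟪toEuclideanLin (diagonal s * Xᵀ) (y - toEuclideanLin (X * diagonal s) β), e⟫ +
      1 / 2 * ‖toEuclideanLin (X * diagonal s) e‖ ^ 2 := by
    have h1 : y - toEuclideanLin (X * diagonal s) b =
        (y - toEuclideanLin (X * diagonal s) β) - toEuclideanLin (X * diagonal s) e := by
      rw [hbe, map_add]; abel
    rw [h1, norm_sub_sq_real, inner_toEuclideanLin_left]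
    have h2 : (diagonal s * Xᵀ)ᵀ = X * diagonal s := by simp
    rw [h2]; ring
  rw [dropoutRisk, dropoutRisk, integral_dropoutLaw, integral_dropoutLaw]
  simp_rw [key, mul_add, mul_sub, Finset.sum_add_distrib, Finset.sum_sub_distrib]
  have h3 : ∑ s ∈ dropoutSupport d, dropoutWeight d p s *
      ⟪toEuclideanLin (diagonal s * Xᵀ) (y - toEuclideanLin (X * diagonal s) β), e⟫ = 0 := by
    simp_rw [← real_inner_smul_left]
    rw [← sum_inner, sum_gradient_eq_zero X hX p hp1, inner_zero_left]
  have h4 : ∑ s ∈ dropoutSupport d, dropoutWeight d p s *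
      (1 / 2 * ‖toEuclideanLin (X * diagonal s) e‖ ^ 2) =
      1 / 2 * (p * ⟪e, toEuclideanLin (rescaled p (gram X)) e⟫) := by
    rw [← sum_norm_mul_diagonal_sq, Finset.mul_sum]
    exact Finset.sum_congr rfl fun s _ => by ring
  rw [h3, h4]
  have h5 : 0 < κ * ‖e‖ ^ 2 := by positivity
  have h6 := mul_pos hp (h5.trans_le (hκ e))
  linarith

/-! ### The affine system of the dropout recursion -/

/-- The rate depends only on the linear part, so one `r` serves the original and the centred
offsets, for every `y`. -/
lemma exists_affineSystem (X : Matrix (Fin m) (Fin d) ℝ)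
    (hX : ∀ j, ∃ i, X i j ≠ 0) (p : unitInterval) (hp0 : 0 < p) (hp1 : p < 1)
    {α : ℝ} (hα0 : 0 < α)
    (hα : α * ‖toEuclideanCLM (n := Fin d) (𝕜 := ℝ) (gram X)‖ < 2) :
    ∃ r, ∀ c : (Fin d → ℝ) → EuclideanSpace ℝ (Fin d), Measurable c →
      AffineSystem (dropoutSupport d) (dropoutWeight d p) (stepLin X α) c r := by
  obtain ⟨κ, hκ0, hκ⟩ := rescaled_gram_lower_bound X hX p hp1
  have hp : (0 : ℝ) < p := hp0
  set γ := α * (2 - α * ‖toEuclideanCLM (n := Fin d) (𝕜 := ℝ) (gram X)‖) with hγ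
  have hγ0 : 0 < γ := mul_pos hα0 (by linarith)
  -- The maximum only secures a nonnegative rate.
  refine ⟨max 0 (1 - γ * (p * κ)), fun c hc => ⟨fun s _ => dropoutWeight_nonneg p s,
    sum_dropoutWeight p, le_max_left _ _, max_lt one_pos ?_, fun s hs v => ?_, fun v => ?_, ?_⟩⟩
  · have : 0 < γ * (p * κ) := by positivity
    linarith
  · refine (le_abs_self _).trans (abs_le_of_sq_le_sq ?_ (norm_nonneg v))
    refine (norm_stepLin_sq_le X hs v).trans ?_
    have : 0 ≤ γ * ‖toEuclideanLin (X * diagonal s) v‖ ^ 2 := by positivity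
    linarith
  · calc _ ≤ ∑ s ∈ dropoutSupport d, dropoutWeight d p s *
          (‖v‖ ^ 2 - γ * ‖toEuclideanLin (X * diagonal s) v‖ ^ 2) :=
          Finset.sum_le_sum fun s hs =>
            mul_le_mul_of_nonneg_left (norm_stepLin_sq_le X hs v) (dropoutWeight_nonneg p s)
      _ = ‖v‖ ^ 2 - γ * (p * ⟪v, toEuclideanLin (rescaled p (gram X)) v⟫) := by
          rw [← sum_norm_mul_diagonal_sq, Finset.mul_sum]
          simp_rw [mul_sub, Finset.sum_sub_distrib]
          rw [← Finset.sum_mul, sum_dropoutWeight, one_mul]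
          congr 1
          exact Finset.sum_congr rfl fun s _ => by ring
      _ ≤ ‖v‖ ^ 2 - γ * (p * (κ * ‖v‖ ^ 2)) := by gcongr; exact hκ v
      _ = (1 - γ * (p * κ)) * ‖v‖ ^ 2 := by ring
      _ ≤ _ := by gcongr; exact le_max_right _ _
  · have h1 : Measurable fun z : (Fin d → ℝ) × EuclideanSpace ℝ (Fin d) =>
        gdStep X 0 α z.1 z.2 :=
      ((continuous_gdStep X α).comp (continuous_fst.prodMk
        (continuous_snd.prodMk continuous_const))).measurable
    have h2 : Measurable fun z : (Fin d → ℝ) × EuclideanSpace ℝ (Fin d) =>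
        gdStep X 0 α z.1 0 :=
      ((continuous_gdStep X α).comp (continuous_fst.prodMk
        (continuous_const.prodMk continuous_const))).measurable
    have h3 := (h1.sub h2).add (hc.comp measurable_fst)
    convert h3 using 1
    ext1 z
    have h4 := gdStep_add X 0 α z.1 0 z.2
    rw [zero_add] at h4
    simp [h4, affineStep]

lemma measurable_gdStep (X : Matrix (Fin m) (Fin d) ℝ) (y : EuclideanSpace ℝ (Fin m)) (α : ℝ)
    (b : EuclideanSpace ℝ (Fin d)) : Measurable fun s => gdStep X y α s b :=
  ((continuous_gdStep X α).comp (continuous_id.prodMk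
    (continuous_const.prodMk continuous_const))).measurable

lemma gdIterate_eq_forwardIter (X : Matrix (Fin m) (Fin d) ℝ) (y : EuclideanSpace ℝ (Fin m)) (α : ℝ)
    (δ : ℤ → Fin d → ℝ) (b₀ β : EuclideanSpace ℝ (Fin d)) (k : ℕ) :
    gdIterate X y α δ b₀ k - β = forwardIter
      (affineStep (stepLin X α) fun s => gdStep X y α s β - β) δ (b₀ - β) k := by
  induction k with
  | zero => rfl
  | succ k ih =>
    rw [gdIterate, forwardIter, ← ih, affineStep, ← add_sub_assoc, ← gdStep_add, add_sub_cancel]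

lemma gdBackward_eq_backwardIter (X : Matrix (Fin m) (Fin d) ℝ) (y : EuclideanSpace ℝ (Fin m))
    (α : ℝ) (δ : ℤ → Fin d → ℝ) (k : ℤ) (j : ℕ) (b : EuclideanSpace ℝ (Fin d)) :
    gdBackward X y α δ k j b = backwardIter
      (affineStep (stepLin X α) fun s => gdStep X y α s 0) δ k j b := by
  rw [← gdStep_eq_affineStep]
  induction j generalizing b with
  | zero => rfl
  | succ j ih => rw [gdBackward, backwardIter, ih]

lemma gdStationary_eq_stationaryIter (X : Matrix (Fin m) (Fin d) ℝ) (y : EuclideanSpace ℝ (Fin m))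
    (α : ℝ) (δ : ℤ → Fin d → ℝ) (k : ℤ) :
    gdStationary X y α δ k = stationaryIter
      (affineStep (stepLin X α) fun s => gdStep X y α s 0) δ k := by
  simp only [gdStationary, stationaryIter, gdBackward_eq_backwardIter]

lemma gdError_eq (X : Matrix (Fin m) (Fin d) ℝ) (p : unitInterval) (y : EuclideanSpace ℝ (Fin m))
    (α : ℝ) (δ : ℤ → Fin d → ℝ) (b₀ : EuclideanSpace ℝ (Fin d)) (n : ℕ) :
    gdError X p y α δ b₀ n =
      (√n)⁻¹ • ∑ k ∈ Finset.range n, (gdIterate X y α δ b₀ (k + 1) - regEstimator X p y) := by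
  rcases Nat.eq_zero_or_pos n with hn | hn
  · subst hn; simp [gdError]
  · have hn0 : (0 : ℝ) < n := by exact_mod_cast hn
    have hs : √(n : ℝ) ≠ 0 := (Real.sqrt_pos.2 hn0).ne'
    have h1 : ∑ k ∈ Finset.Icc 1 n, gdIterate X y α δ b₀ k =
        ∑ k ∈ Finset.range n, gdIterate X y α δ b₀ (k + 1) := by
      rw [Finset.range_eq_Ico, Finset.sum_Ico_add' (fun k => gdIterate X y α δ b₀ k) 0 n 1]
      rfl
    rw [gdError, gdAverage, h1, Finset.sum_sub_distrib, smul_sub, smul_sub, smul_smul]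
    simp only [Finset.sum_const, Finset.card_range]
    rw [← Nat.cast_smul_eq_nsmul ℝ, smul_smul]
    congr 2
    · rw [inv_eq_one_div, mul_one_div, div_eq_div_iff hn0.ne' hs, Real.mul_self_sqrt hn0.le, one_mul]
    · rw [eq_inv_mul_iff_mul_eq₀ hs, Real.mul_self_sqrt hn0.le]

end

end GDDropout

/-! ### The central limit theorem, for fixed data and conditionally on random data. -/

namespace GDDropout

noncomputable section

set_option linter.unusedSectionVars false

open scoped RealInnerProductSpace
open Matrix RandomAffine

variable {m d : ℕ}

/-- Translating a stationary process. -/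
lemma isStationaryProcess_sub {Ω : Type*} [MeasurableSpace Ω] {P : Measure Ω}
    [IsProbabilityMeasure P] {X : Matrix (Fin m) (Fin d) ℝ} {y : EuclideanSpace ℝ (Fin m)} {α : ℝ}
    {x : ℤ → Ω → Fin d → ℝ} {Z : ℤ → Ω → EuclideanSpace ℝ (Fin d)}
    (hZ : IsStationaryProcess P x (stepLin X α) (fun s => gdStep X y α s 0) Z)
    (β : EuclideanSpace ℝ (Fin d)) :
    IsStationaryProcess P x (stepLin X α) (fun s => gdStep X y α s β - β)
      fun k ω => Z k ω - β where
  meas k := (hZ.meas k).sub_const β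
  memLp k := (hZ.memLp k).sub (memLp_const β)
  step k := by
    filter_upwards [hZ.step k] with ω hω
    rw [hω, ← gdStep_eq_affineStep, affineStep, ← add_sub_assoc, ← gdStep_add, add_sub_cancel]
  indep l k hlk := (hZ.indep l k hlk).comp
    (φ := fun q : EuclideanSpace ℝ (Fin d) × EuclideanSpace ℝ (Fin d) => (q.1 - β, q.2 - β))
    (ψ := id) (by fun_prop) measurable_id
  map_eq k l := by
    have h (k : ℤ) : P.map (fun ω => Z k ω - β) = (P.map (Z k)).map fun v => v - β := by
      rw [Measure.map_map (by fun_prop) (hZ.meas k)]; rfl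
    rw [h, h, hZ.map_eq k l]

section Fixed

variable {X : Matrix (Fin m) (Fin d) ℝ} {p : unitInterval} {α : ℝ}
  {Ω : Type*} [MeasurableSpace Ω] {P : Measure Ω} [IsProbabilityMeasure P]
  {δ : ℤ → Ω → Fin d → ℝ}

lemma iidInput (hδ : ∀ k, Measurable (δ k)) (hlaw : ∀ k, P.map (δ k) = dropoutLaw d p)
    (hindep : iIndepFun δ P) : IIDInput P δ (dropoutSupport d) (dropoutWeight d p) where
  meas := hδ
  indep := hindep
  ae_mem k := by
    have := ae_mem_dropoutSupport (d := d) p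
    rw [← hlaw k] at this
    exact ae_of_ae_map (hδ k).aemeasurable this
  prob k s _ := by
    rw [dropoutWeight, ← hlaw k, map_measureReal_apply (hδ k) (measurableSet_singleton s)]

variable {y : EuclideanSpace ℝ (Fin m)} {r : ℝ}

/-- The stationary distribution is the law of the stationary iterate. -/
theorem isStationaryLaw_iff
    (h : AffineSystem (dropoutSupport d) (dropoutWeight d p) (stepLin X α)
      (fun s => gdStep X y α s 0) r) (hx : IIDInput P δ (dropoutSupport d) (dropoutWeight d p))
    (hlaw : ∀ k, P.map (δ k) = dropoutLaw d p) (k : ℤ) (π : Measure (EuclideanSpace ℝ (Fin d))) :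
    IsStationaryLaw X p y α π ↔
      π = P.map (fun ω => gdStationary X y α (fun l => δ l ω) k) := by
  have hm : Measurable fun z : EuclideanSpace ℝ (Fin d) × (Fin d → ℝ) => gdStep X y α z.2 z.1 :=
    ((continuous_gdStep X α).comp (continuous_snd.prodMk
      (continuous_fst.prodMk continuous_const))).measurable
  have hZ := isStationaryProcess_stationaryIter h hx
  simp only [gdStationary_eq_stationaryIter]
  constructor
  · rintro ⟨hπ, hst⟩
    refine eq_map_stationaryIter h hx (fun g hg ⟨C, hC⟩ => ?_) k
    have hint : Integrable (fun z : EuclideanSpace ℝ (Fin d) × (Fin d → ℝ) =>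
        g (gdStep X y α z.2 z.1)) (π.prod (dropoutLaw d p)) :=
      Integrable.of_bound (hg.comp hm).aestronglyMeasurable C (ae_of_all _ fun z => hC _)
    conv_rhs => rw [← hst]
    rw [integral_map hm.aemeasurable hg.aestronglyMeasurable, integral_prod _ hint]
    simp_rw [integral_dropoutLaw]
    rw [← gdStep_eq_affineStep]
  · intro hπ
    -- The iterate at time `k - 1` is independent of `δ k`, so their joint law is the product to
    -- which the gradient step is applied.
    have hmk := hZ.meas (k - 1)
    have hind := (hZ.indep (k - 1) (k - 1) le_rfl).comp measurable_fst measurable_id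
    rw [sub_add_cancel] at hind
    have hprod := (indepFun_iff_map_prod_eq_prod_map_map hmk.aemeasurable
      (hx.meas k).aemeasurable).1 hind
    refine ⟨hπ ▸ Measure.isProbabilityMeasure_map (hZ.meas k).aemeasurable, ?_⟩
    conv_lhs => rw [hπ, hZ.map_eq k (k - 1), ← hlaw k, ← hprod]
    rw [Measure.map_map hm (hmk.prodMk (hx.meas k)), hπ]
    refine Measure.map_congr ?_
    filter_upwards [hZ.step k] with ω hω
    rw [hω, ← gdStep_eq_affineStep]
    rfl

/-- The hypotheses on the system centred at the regularized estimator. -/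
structure CentredSystem (X : Matrix (Fin m) (Fin d) ℝ) (p : unitInterval)
    (y : EuclideanSpace ℝ (Fin m)) (α : ℝ) (P : Measure Ω) (δ : ℤ → Ω → Fin d → ℝ) (r : ℝ) :
    Prop where
  input : IIDInput P δ (dropoutSupport d) (dropoutWeight d p)
  system : AffineSystem (dropoutSupport d) (dropoutWeight d p) (stepLin X α)
    (fun s => gdStep X y α s (regEstimator X p y) - regEstimator X p y) r
  mean : ∑ s ∈ dropoutSupport d, dropoutWeight d p s •
    (gdStep X y α s (regEstimator X p y) - regEstimator X p y) = 0
  process : IsStationaryProcess P δ (stepLin X α)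
    (fun s => gdStep X y α s (regEstimator X p y) - regEstimator X p y)
    fun k ω => gdStationary X y α (fun l => δ l ω) k - regEstimator X p y

lemma gdStep_regEstimator_mean (hX : ∀ j, ∃ i, X i j ≠ 0) (hp1 : p < 1) :
    ∑ s ∈ dropoutSupport d, dropoutWeight d p s •
      (gdStep X y α s (regEstimator X p y) - regEstimator X p y) = 0 := by
  have := congrArg (fun v => α • v) (sum_gradient_eq_zero X hX p hp1 y)
  simp only [Finset.smul_sum, smul_zero] at this
  rw [← this]
  refine Finset.sum_congr rfl fun s _ => ?_
  rw [gdStep, add_sub_cancel_left, smul_comm]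

namespace CentredSystem

lemma inner_single (v : EuclideanSpace ℝ (Fin d)) (i : Fin d) :
    ⟪v, EuclideanSpace.single i (1 : ℝ)⟫ = v i := by
  simp [EuclideanSpace.inner_single_right]

/-- The stationary mean is the regularized estimator, so covariances are second moments of the
centred process. -/
lemma stationaryCov_eq (h : CentredSystem X p y α P δ r) (k : ℤ) (i j : Fin d) :
    stationaryCov X y α P δ k i j =
      ∫ ω, ⟪gdStationary X y α (fun l => δ l ω) 0 - regEstimator X p y,
          EuclideanSpace.single i (1 : ℝ)⟫ *
        ⟪gdStationary X y α (fun l => δ l ω) k - regEstimator X p y,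
          EuclideanSpace.single j (1 : ℝ)⟫ ∂P := by
  have hmean (k : ℤ) (i : Fin d) :
      ∫ ω, gdStationary X y α (fun l => δ l ω) k i ∂P = regEstimator X p y i := by
    have h1 := h.process.integral_inner_eq_zero h.system h.input
      (fun s _ => inner_stepLin X α s) h.mean k (EuclideanSpace.single i (1 : ℝ))
    have h2 : Integrable (fun ω => ⟪gdStationary X y α (fun l => δ l ω) k - regEstimator X p y,
        EuclideanSpace.single i (1 : ℝ)⟫) P :=
      (h.process.memLp_inner k _).integrable (by norm_num)
    simp only [inner_single, PiLp.sub_apply] at h1 h2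
    have h3 : Integrable (fun ω => gdStationary X y α (fun l => δ l ω) k i) P := by
      refine (h2.add (integrable_const (regEstimator X p y i))).congr (ae_of_all _ fun ω => ?_)
      simp
    rw [integral_sub h3 (integrable_const _)] at h1
    simp at h1
    linarith
  rw [stationaryCov, covariance, hmean, hmean]
  simp only [inner_single, PiLp.sub_apply]

lemma exists_coordinate_solutions (h : CentredSystem X p y α P δ r) :
    ∃ z : Fin d → EuclideanSpace ℝ (Fin d), ∀ i, z i -
      meanMap (dropoutSupport d) (dropoutWeight d p) (stepLin X α) (z i) =
        EuclideanSpace.single i (1 : ℝ) := by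
  choose z hz using fun i : Fin d =>
    h.system.exists_sub_meanMap_eq (EuclideanSpace.single i (1 : ℝ))
  exact ⟨z, hz⟩

lemma summable_stationaryCov (h : CentredSystem X p y α P δ r) (i j : Fin d) :
    Summable fun k : ℤ => stationaryCov X y α P δ k i j := by
  obtain ⟨z, hz⟩ := h.exists_coordinate_solutions
  have := h.process.hasSum_integral_mul h.system h.input
      (fun s _ => inner_stepLin X α s) h.mean (hz i) (hz j)
  simp_rw [h.stationaryCov_eq]
  exact this.summable

lemma longRunCov_comm (h : CentredSystem X p y α P δ r) (i j : Fin d) :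
    longRunCov X y α P δ i j = longRunCov X y α P δ j i := by
  obtain ⟨z, hz⟩ := h.exists_coordinate_solutions
  have key (i j : Fin d) := (h.process.hasSum_integral_mul h.system h.input
      (fun s _ => inner_stepLin X α s) h.mean (hz i) (hz j)).tsum_eq
  simp only [longRunCov, Matrix.of_apply, h.stationaryCov_eq]
  rw [key, key, IsStationaryProcess.secondMoment_comm (EuclideanSpace.single i (1 : ℝ))
    (EuclideanSpace.single j (1 : ℝ))]
  ring

/-- The quadratic form of the long-run covariance. -/
lemma dotProduct_longRunCov (h : CentredSystem X p y α P δ r)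
    {u z : EuclideanSpace ℝ (Fin d)}
    (hz : z - meanMap (dropoutSupport d) (dropoutWeight d p) (stepLin X α) z = u) :
    (u : Fin d → ℝ) ⬝ᵥ longRunCov X y α P δ *ᵥ (u : Fin d → ℝ) =
      IsStationaryProcess.secondMoment P
          (fun k ω => gdStationary X y α (fun l => δ l ω) k - regEstimator X p y) u z +
        (IsStationaryProcess.secondMoment P
          (fun k ω => gdStationary X y α (fun l => δ l ω) k - regEstimator X p y) u z -
        IsStationaryProcess.secondMoment P
          (fun k ω => gdStationary X y α (fun l => δ l ω) k - regEstimator X p y) u u) := by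
  have h1 := h.process.hasSum_integral_mul h.system h.input
      (fun s _ => inner_stepLin X α s) h.mean hz hz
  have h2 : HasSum (fun k : ℤ => ∑ i, ∑ j, u i * u j * stationaryCov X y α P δ k i j)
      (∑ i, ∑ j, u i * u j * longRunCov X y α P δ i j) :=
    hasSum_sum fun i _ => hasSum_sum fun j _ =>
      ((h.summable_stationaryCov i j).hasSum).mul_left _
  have h3 (k : ℤ) : ∑ i, ∑ j, u i * u j * stationaryCov X y α P δ k i j =
      ∫ ω, ⟪gdStationary X y α (fun l => δ l ω) 0 - regEstimator X p y, u⟫ *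
        ⟪gdStationary X y α (fun l => δ l ω) k - regEstimator X p y, u⟫ ∂P := by
    simp_rw [h.stationaryCov_eq, ← integral_const_mul]
    have hi (i j : Fin d) := (h.process.integrable_mul 0 k (EuclideanSpace.single i (1 : ℝ))
      (EuclideanSpace.single j (1 : ℝ))).const_mul (u i * u j)
    rw [Finset.sum_congr rfl fun i _ => (integral_finsetSum _ fun j _ => hi i j).symm,
      ← integral_finsetSum _ fun i _ => integrable_finsetSum _ fun j _ => hi i j]
    refine integral_congr_ae (ae_of_all _ fun ω => ?_)
    simp only [inner_single]
    simp only [PiLp.inner_apply, RCLike.inner_apply, conj_trivial, Finset.sum_mul_sum]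
    exact Finset.sum_congr rfl fun i _ => Finset.sum_congr rfl fun j _ => by ring
  simp_rw [h3] at h2
  rw [← h2.unique h1]
  simp only [dotProduct, mulVec, Finset.mul_sum]
  exact Finset.sum_congr rfl fun i _ => Finset.sum_congr rfl fun j _ => by ring

/-- The constant of the Poisson equation is half the quadratic form of the long-run covariance.
Being half an integrated conditional variance, it is nonnegative, which also yields positive
semidefiniteness. -/
lemma nonneg_and_tendsto_charFun (h : CentredSystem X p y α P δ r) (u : EuclideanSpace ℝ (Fin d)) :
    0 ≤ (u : Fin d → ℝ) ⬝ᵥ longRunCov X y α P δ *ᵥ (u : Fin d → ℝ) ∧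
      ∀ b₀, Tendsto (fun n : ℕ => ∫ ω, Complex.exp (Complex.I *
        (⟪gdError X p y α (fun l => δ l ω) b₀ n, u⟫ : ℝ)) ∂P) atTop
        (𝓝 (Complex.exp (-(((u : Fin d → ℝ) ⬝ᵥ longRunCov X y α P δ *ᵥ (u : Fin d → ℝ) / 2 : ℝ) :
          ℂ)))) := by
  have hsymm := fun s (_ : s ∈ dropoutSupport d) => inner_stepLin X α s
  obtain ⟨z, hz⟩ := h.system.exists_sub_meanMap_eq u
  obtain ⟨g, σ, C, hgc, hC, hgC, hg⟩ := h.system.exists_corrector hsymm z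
  obtain ⟨hσ0, hσ⟩ := h.process.two_mul_corrector_const h.system h.input hsymm h.mean hz hgc hgC hg
  rw [← h.dotProduct_longRunCov hz] at hσ
  have e : (u : Fin d → ℝ) ⬝ᵥ longRunCov X y α P δ *ᵥ (u : Fin d → ℝ) / 2 = σ := by linarith
  refine ⟨by linarith, fun b₀ => ?_⟩
  rw [e]
  have := tendsto_integral_exp_partial_sum h.system h.input hsymm h.mean hz hgc hC hgC hg
    (b₀ - regEstimator X p y)
  refine this.congr fun n => integral_congr_ae (ae_of_all _ fun ω => ?_)
  simp only [gdError_eq, ← gdIterate_eq_forwardIter, real_inner_smul_left, sum_inner]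
  simp_rw [real_inner_comm u]

theorem posSemidef_longRunCov (h : CentredSystem X p y α P δ r) :
    (longRunCov X y α P δ).PosSemidef := by
  refine PosSemidef.of_dotProduct_mulVec_nonneg ?_ fun v => ?_
  · ext i j
    simpa using h.longRunCov_comm j i
  · simpa using (h.nonneg_and_tendsto_charFun (WithLp.toLp 2 v)).1

end CentredSystem

/-- Joint measurability in data and inputs is what conditioning on the data requires. -/
lemma measurable_gdError (X : Matrix (Fin m) (Fin d) ℝ) (p : unitInterval) (α : ℝ)
    (b₀ : EuclideanSpace ℝ (Fin d)) (n : ℕ) :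
    Measurable fun q : EuclideanSpace ℝ (Fin m) × (ℤ → Fin d → ℝ) =>
      gdError X p q.1 α q.2 b₀ n := by
  have h (k : ℕ) : Measurable fun q : EuclideanSpace ℝ (Fin m) × (ℤ → Fin d → ℝ) =>
      gdIterate X q.1 α q.2 b₀ k := by
    induction k with
    | zero => exact measurable_const
    | succ k ih =>
      have h1 : Measurable fun q : EuclideanSpace ℝ (Fin m) × (ℤ → Fin d → ℝ) =>
        q.2 ((k : ℤ) + 1) := (measurable_pi_apply _).comp measurable_snd
      exact (continuous_gdStep X α).measurable.comp (h1.prodMk (ih.prodMk measurable_fst))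
  have h2 : Measurable fun q : EuclideanSpace ℝ (Fin m) × (ℤ → Fin d → ℝ) =>
      regEstimator X p q.1 :=
    (LinearMap.continuous_of_finiteDimensional _).measurable.comp measurable_fst
  simp only [gdError_eq]
  exact (Finset.measurable_sum _ fun k _ => (h (k + 1)).sub h2).const_smul (√(n : ℝ))⁻¹

/-- The central limit theorem for fixed data. -/
theorem CentredSystem.tendsto_map_gdError (h : CentredSystem X p y α P δ r)
    (b₀ : EuclideanSpace ℝ (Fin d))
    (hm : ∀ n, AEMeasurable (fun ω => gdError X p y α (fun l => δ l ω) b₀ n) P) :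
    Tendsto (β := ProbabilityMeasure (EuclideanSpace ℝ (Fin d)))
      (fun n => ⟨P.map (fun ω => gdError X p y α (fun l => δ l ω) b₀ n),
        Measure.isProbabilityMeasure_map (hm n)⟩) atTop
      (𝓝 ⟨multivariateGaussian 0 (longRunCov X y α P δ), inferInstance⟩) := by
  refine ProbabilityMeasure.tendsto_of_tendsto_charFun fun u => ?_
  have h1 := (h.nonneg_and_tendsto_charFun u).2 b₀
  simp only [ProbabilityMeasure.coe_mk]
  rw [charFun_multivariateGaussian h.posSemidef_longRunCov]
  refine Tendsto.congr (fun n => ?_) (h1.trans (le_of_eq ?_))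
  · rw [charFun_apply, integral_map (hm n) (by fun_prop)]
    simp only [mul_comm Complex.I]
  · congr 2
    simp

end Fixed

/-- The conditional law of `G(Y, D)` given `Y`, when `D` is independent of `Y`. -/
theorem condDistrib_ae_eq_map_of_indepFun {Ω 𝓨 𝓓 F : Type*} [MeasurableSpace Ω] {P : Measure Ω}
    [IsProbabilityMeasure P] [MeasurableSpace 𝓨] [MeasurableSpace 𝓓] [MeasurableSpace F]
    [StandardBorelSpace F] [Nonempty F] {Y : Ω → 𝓨} {D : Ω → 𝓓} {G : 𝓨 × 𝓓 → F}
    (hY : Measurable Y) (hD : Measurable D) (hG : Measurable G) (hind : IndepFun Y D P) :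
    ∀ᵐ ω ∂P, condDistrib (fun ω' => G (Y ω', D ω')) Y P (Y ω) =
      P.map (fun ω' => G (Y ω, D ω')) := by
  have hGy (y : 𝓨) : Measurable fun x => G (y, x) := hG.comp (measurable_const.prodMk measurable_id)
  have := Measure.isProbabilityMeasure_map (μ := P) hD.aemeasurable
  have := Measure.isProbabilityMeasure_map (μ := P) hY.aemeasurable
  let κ : Kernel 𝓨 F := ⟨fun y => (P.map D).map fun x => G (y, x), by
    refine Measure.measurable_of_measurable_coe _ fun s hs => ?_
    simp_rw [fun y => Measure.map_apply (μ := P.map D) (hGy y) hs]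
    exact measurable_measure_prodMk_left (hG hs)⟩
  have hκ (y : 𝓨) : κ y = (P.map D).map fun x => G (y, x) := rfl
  have : IsMarkovKernel κ := ⟨fun y => by
    rw [hκ]; exact Measure.isProbabilityMeasure_map (hGy y).aemeasurable⟩
  have hprod := (indepFun_iff_map_prod_eq_prod_map_map hY.aemeasurable hD.aemeasurable).1 hind
  have hH : Measurable fun q : 𝓨 × 𝓓 => (q.1, G q) := measurable_fst.prodMk hG
  -- By the product law of `(Y, D)` and Tonelli, the law of `(Y, G(Y, D))` disintegrates along `κ`;
  -- uniqueness of disintegrations finishes.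
  have h1 := condDistrib_ae_eq_of_measure_eq_compProd_of_measurable (μ := P) hY
    (hG.comp (hY.prodMk hD)) (κ := κ) (by
      have e : P.map (fun ω => (Y ω, (G ∘ fun ω => (Y ω, D ω)) ω)) =
          ((P.map Y).prod (P.map D)).map fun q => (q.1, G q) := by
        rw [← hprod, Measure.map_map hH (hY.prodMk hD)]; rfl
      rw [e]
      ext s hs
      rw [Measure.map_apply hH hs, Measure.prod_apply (hH hs), Measure.compProd_apply hs]
      refine lintegral_congr fun y => ?_
      rw [hκ, Measure.map_apply (hGy y) (measurable_prodMk_left hs)]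
      rfl)
  filter_upwards [ae_of_ae_map hY.aemeasurable h1] with ω hω
  refine hω.trans ?_
  rw [hκ, Measure.map_map (hGy _) hD]
  rfl

end

end GDDropout

/-! ### Assembly of the main theorem. -/

theorem mainTheorem3 {m d : ℕ} (X : Matrix (Fin m) (Fin d) ℝ) (hX : ∀ j, ∃ i, X i j ≠ 0)
    (p : unitInterval) (hp0 : 0 < p) (hp1 : p < 1)
    (α : ℝ) (hα0 : 0 < α)
    (hα : α * ‖Matrix.toEuclideanCLM (n := Fin d) (𝕜 := ℝ) (GDDropout.gram X)‖ < 2)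
    {Ω : Type*} [MeasurableSpace Ω] (P : Measure Ω) [IsProbabilityMeasure P]
    -- `δ k` is the diagonal of the dropout matrix `D_k`; the `D_k` are i.i.d.
    (δ : ℤ → Ω → Fin d → ℝ) (hδ : ∀ k, Measurable (δ k))
    (hlaw : ∀ k, P.map (δ k) = GDDropout.dropoutLaw d p) (hindep : iIndepFun δ P) :
    -- conditionally on the data, that is, for every fixed value of `y`
    (∀ y : EuclideanSpace ℝ (Fin m),
      -- the centering is the unique minimizer of the averaged dropout loss
      (∀ b, b ≠ GDDropout.regEstimator X p y →
        GDDropout.dropoutRisk X p y (GDDropout.regEstimator X p y) <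
          GDDropout.dropoutRisk X p y b) ∧
      -- the stationary process exists almost surely, whatever the starting vector
      (∀ k : ℤ, ∀ᵐ ω ∂P, ∀ b,
        Tendsto (fun j => GDDropout.gdBackward X y α (fun l => δ l ω) k j b) atTop
          (𝓝 (GDDropout.gdStationary X y α (fun l => δ l ω) k))) ∧
      -- its marginals are the unique stationary distribution
      (∀ (k : ℤ) (π : Measure (EuclideanSpace ℝ (Fin d))),
        GDDropout.IsStationaryLaw X p y α π ↔
          π = P.map (fun ω => GDDropout.gdStationary X y α (fun l => δ l ω) k)) ∧
      -- its long-run covariance matrix is well defined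
      (∀ k : ℤ, MemLp (fun ω => GDDropout.gdStationary X y α (fun l => δ l ω) k) 2 P) ∧
      (∀ i j, Summable fun k : ℤ => GDDropout.stationaryCov X y α P δ k i j) ∧
      (GDDropout.longRunCov X y α P δ).PosSemidef ∧
      -- the central limit theorem, for every initial vector
      (∀ b₀ : EuclideanSpace ℝ (Fin d),
        TendstoInDistribution (fun (n : ℕ) ω => GDDropout.gdError X p y α (fun l => δ l ω) b₀ n)
          atTop id (fun _ => P) (multivariateGaussian 0 (GDDropout.longRunCov X y α P δ)))) ∧
    -- the same for the random data `y = X β* + ε`, with noise independent of the dropout: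
    -- weak convergence of the regular conditional distributions given `y`
    (∀ (βstar : EuclideanSpace ℝ (Fin d)) (ε : Ω → EuclideanSpace ℝ (Fin m)), Measurable ε →
      IndepFun ε (fun ω k => δ k ω) P →
      ∀ b₀ : EuclideanSpace ℝ (Fin d), ∀ᵐ ω ∂P,
        Tendsto (β := ProbabilityMeasure (EuclideanSpace ℝ (Fin d)))
          (fun n : ℕ => ⟨condDistrib
            (fun ω' => GDDropout.gdError X p (GDDropout.response X βstar (ε ω')) α
              (fun l => δ l ω') b₀ n)
            (fun ω' => GDDropout.response X βstar (ε ω')) P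
            (GDDropout.response X βstar (ε ω)), inferInstance⟩)
          atTop
          (𝓝 ⟨multivariateGaussian 0
            (GDDropout.longRunCov X (GDDropout.response X βstar (ε ω)) α P δ),
            inferInstance⟩)) := by
  have hx := GDDropout.iidInput hδ hlaw hindep
  obtain ⟨r, hr⟩ := GDDropout.exists_affineSystem X hX p hp0 hp1 hα0 hα
  have hsys (y : EuclideanSpace ℝ (Fin m)) := hr _ (GDDropout.measurable_gdStep X y α 0)
  have hZ (y : EuclideanSpace ℝ (Fin m)) := RandomAffine.isStationaryProcess_stationaryIter
    (hsys y) hx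
  simp only [← GDDropout.gdStationary_eq_stationaryIter] at hZ
  have hC (y : EuclideanSpace ℝ (Fin m)) : GDDropout.CentredSystem X p y α P δ r :=
    ⟨hx, hr _ ((GDDropout.measurable_gdStep X y α _).sub_const _),
      GDDropout.gdStep_regEstimator_mean hX hp1, GDDropout.isStationaryProcess_sub (hZ y) _⟩
  have hD : Measurable fun ω k => δ k ω := measurable_pi_lambda _ hδ
  have hm (y : EuclideanSpace ℝ (Fin m)) (b₀ : EuclideanSpace ℝ (Fin d)) (n : ℕ) :
      AEMeasurable (fun ω => GDDropout.gdError X p y α (fun l => δ l ω) b₀ n) P :=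
    ((GDDropout.measurable_gdError X p α b₀ n).comp (measurable_const.prodMk hD)).aemeasurable
  refine ⟨fun y => ⟨GDDropout.dropoutRisk_regEstimator_lt X hX p hp0 hp1 y, fun k => ?_,
    GDDropout.isStationaryLaw_iff (hsys y) hx hlaw,
    fun k => ((hZ y).memLp k).mono_exponent (by norm_num),
    (hC y).summable_stationaryCov, (hC y).posSemidef_longRunCov, fun b₀ => ?_⟩,
    fun βstar ε hε hεδ b₀ => ?_⟩
  · simp only [GDDropout.gdBackward_eq_backwardIter, GDDropout.gdStationary_eq_stationaryIter]
    exact RandomAffine.ae_tendsto_backwardIter (hsys y) hx k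
  · refine ⟨hm y b₀, aemeasurable_id, ?_⟩
    convert (hC y).tendsto_map_gdError b₀ (hm y b₀) using 3
    exact congrArg 𝓝 (Subtype.ext Measure.map_id)
  · have hY : Measurable fun ω => GDDropout.response X βstar (ε ω) := hε.const_add _
    have hind : IndepFun (fun ω => GDDropout.response X βstar (ε ω)) (fun ω k => δ k ω) P :=
      hεδ.comp (φ := fun e => GDDropout.response X βstar e) (ψ := id)
        (measurable_id.const_add _) measurable_id
    -- Countably many `n` share one null set; off it, the conditional laws are those for frozen
    -- data, and the theorem for fixed `y` applies.
    have hae : ∀ᵐ ω ∂P, ∀ n, _ := ae_all_iff.2 fun n =>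
      GDDropout.condDistrib_ae_eq_map_of_indepFun hY hD
        (GDDropout.measurable_gdError X p α b₀ n) hind
    filter_upwards [hae] with ω hω
    refine ((hC _).tendsto_map_gdError b₀ (hm _ b₀)).congr fun n => ?_
    exact Subtype.ext (hω n).symm
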